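/- Let $n\ge 3$, let $a_1,\dots,a_n$ be positive integers, let $\Pi=\prod_{i=1}^n\{0,\dots,a_i\}$, and let $C=\prod_{i=1}^n[0,a_i]\subset\mathbb R^n$, regarded as a cubical complex with unit cubes as cells and vertex set $\Pi$. Let $e_1,\dots,e_n$ be the standard basis of $\mathbb R^n$. Fix $0<\theta_1<\dots<\theta_n<\pi$, put $v_i=(\cos\theta_i,\sin\theta_i)$, let $p:C\to\mathbb R^2$ be the map $p(x)=\sum_i x_iv_i$, and let $P=p(C)$, a polygon. A *tiling* is a two-dimensional subcomplex $T\subset C$ such that $p|_T:T\to P$ is a homeomorphism. For $I\in\Pi$ and $j<k<\ell$ such that the cube $c=\{I+xe_j+ye_k+ze_\ell : x,y,z\in[0,1]\}$ is contained in $C$, the *bottom faces* of $c$ are its three two-dimensional faces containing $I+e_k$, and the *top faces* of $c$ are its three two-dimensional faces containing $I+e_j+e_\ell$. Two tilings are related by a *flip* if, for some such cube $c$, one of them contains all the top faces of $c$ and the other is obtained from it by deleting the top faces of $c$ and replacing them with the bottom faces of $c$. **Proposition 3.12.** Let $T$ and $T'$ be two tilings, and let $I_0\in\Pi$ be a vertex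 contained in both $T$ and $T'$. Then there is a finite sequence of tilings $T=T_0,T_1,\dots,T_m=T'$ such that, for each $0\le i<m$, the tilings $T_i$ and $T_{i+1}$ are related by a flip, and such that every $T_i$ contains the vertex $I_0$. -/

import Mathlib

noncomputable section

namespace CubeRecurrence

/-- A closed cell of the standard cubical structure on the nonnegative orthant of `ℝⁿ`:
the cube `base + ∏_{i ∈ dirs} [0,1]·e_i`, of dimension `dirs.card`. -/
@[ext]
structure Face (n : ℕ) where
  /-- the smallest vertex of the cell -/
  base : Fin n → ℕ
  /-- the coordinate directions in which the cell extends -/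
  dirs : Finset (Fin n)

namespace Face

variable {n : ℕ}

/-- The largest vertex of a cell. -/
def top (F : Face n) : Fin n → ℕ := fun i => F.base i + if i ∈ F.dirs then 1 else 0

/-- The dimension of a cell. -/
def dim (F : Face n) : ℕ := F.dirs.card

/-- The closed cell, as a subset of `ℝⁿ`. -/
def toSet (F : Face n) : Set (Fin n → ℝ) :=
  Set.Icc (fun i => (F.base i : ℝ)) (fun i => (F.top i : ℝ))

/-- `F.IsFaceOf G`: the cell `F` is a face (of any dimension) of the cell `G`, that is, the box
`F` is contained in the box `G`. -/
def IsFaceOf (F G : Face n) : Prop := G.base ≤ F.base ∧ F.top ≤ G.top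

/-- The vertex `I`, as a cell of dimension `0`. -/
def vertex (I : Fin n → ℕ) : Face n := ⟨I, ∅⟩

end Face

/-- The space `C(A) = ∏ [0, a_i]`. -/
def boxC {n : ℕ} (a : Fin n → ℕ) : Set (Fin n → ℝ) :=
  Set.Icc 0 (fun i => (a i : ℝ))

/-- The cell `F` belongs to the cubical complex `C(A)`. -/
def InC {n : ℕ} (a : Fin n → ℕ) (F : Face n) : Prop := F.top ≤ a

/-- The projection `π(x) = ∑ x_i v_i`, where `v_i = (cos θ_i, sin θ_i)`. -/
def proj {n : ℕ} (θ : Fin n → ℝ) (x : Fin n → ℝ) : ℝ × ℝ :=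
  ∑ i, x i • (Real.cos (θ i), Real.sin (θ i))

/-- The zonogon `P = π(C)`. -/
def zonogon {n : ℕ} (a : Fin n → ℕ) (θ : Fin n → ℝ) : Set (ℝ × ℝ) := proj θ '' boxC a

/-- The underlying space of a collection of cells. -/
def space {n : ℕ} (K : Set (Face n)) : Set (Fin n → ℝ) := ⋃ F ∈ K, F.toSet

/-- A tiling: a two dimensional subcomplex `T` of `C(A)` such that `π` restricts to a
homeomorphism from (the underlying space of) `T` onto the zonogon `P`. -/
@[ext]
structure Tiling {n : ℕ} (a : Fin n → ℕ) (θ : Fin n → ℝ) where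
  /-- the cells of the subcomplex -/
  faces : Set (Face n)
  inC : ∀ F ∈ faces, InC a F
  closed_under_faces : ∀ G ∈ faces, ∀ F : Face n, F.IsFaceOf G → F ∈ faces
  dim_le_two : ∀ F ∈ faces, F.dim ≤ 2
  homeo : ∃ h : space faces ≃ₜ zonogon a θ, ∀ x, (h x : ℝ × ℝ) = proj θ x

namespace Tiling

variable {n : ℕ} {a : Fin n → ℕ} {θ : Fin n → ℝ}

/-- The vertex set of a tiling, as a subset of `ℕⁿ`. -/
def vert (T : Tiling a θ) : Set (Fin n → ℕ) := {I | Face.vertex I ∈ T.faces}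

/-- The two dimensional cells (rhombi) of a tiling. Since the underlying space is homeomorphic to
a polygon, every cell of a tiling is a face of one of these, so they determine the tiling. -/
def rhombi (T : Tiling a θ) : Set (Face n) := {F ∈ T.faces | F.dim = 2}

end Tiling

/-- The cube `{I + x e_j + y e_k + z e_l | x, y, z ∈ [0,1]}`. -/
def cube {n : ℕ} (I : Fin n → ℕ) (j k l : Fin n) : Face n := ⟨I, {j, k, l}⟩

/-- The bottom faces of the cube at `I` in the directions `j < k < l`: its two dimensional faces
containing `I + e_k`. -/
def bottomFaces {n : ℕ} (I : Fin n → ℕ) (j k l : Fin n) : Set (Face n) :=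
  {F | F.IsFaceOf (cube I j k l) ∧ F.dim = 2 ∧ (Face.vertex (I + Pi.single k 1)).IsFaceOf F}

/-- The top faces of the cube at `I` in the directions `j < k < l`: its two dimensional faces
containing `I + e_j + e_l`. -/
def topFaces {n : ℕ} (I : Fin n → ℕ) (j k l : Fin n) : Set (Face n) :=
  {F | F.IsFaceOf (cube I j k l) ∧ F.dim = 2 ∧
    (Face.vertex (I + Pi.single j 1 + Pi.single l 1)).IsFaceOf F}

/-- Two tilings are related by a flip: for some three dimensional cube of `C(A)`, one obtains `T'`
from `T` by deleting the top faces of the cube and replacing them with its bottom faces, or the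
other way round. -/
def Flip {n : ℕ} {a : Fin n → ℕ} {θ : Fin n → ℝ} (T T' : Tiling a θ) : Prop :=
  ∃ (I : Fin n → ℕ) (j k l : Fin n), j < k ∧ k < l ∧ InC a (cube I j k l) ∧
    ((topFaces I j k l ⊆ T.rhombi ∧
        T'.rhombi = (T.rhombi \ topFaces I j k l) ∪ bottomFaces I j k l) ∨
      (bottomFaces I j k l ⊆ T.rhombi ∧
        T'.rhombi = (T.rhombi \ bottomFaces I j k l) ∪ topFaces I j k l))

end CubeRecurrence

end

/-! The projection is a homeomorphism on a finite complex exactly when it is bijective onto `P`, so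
everything is done with `IsTiling`. For fixed `I₀` it suffices to flip every tiling, without ever
removing `I₀`, to one and the same collection of cells (`hasNormalForm`): flips are reversible
(`Step.symm`), so two tilings containing `I₀` are joined through that common form.

The normal form is built by induction on `∑ a m`, with `n` fixed and zero sides allowed. Let `d` be
the last direction with `0 < a d`, and suppose `I₀ d < a d`. The rhombi crossing from level `a d -
1` to level `a d` of coordinate `d` form the last strip. As long as it does not run along the upper
boundary of `P`, some cube has all its top faces in the tiling, two of them on the strip
(`exists_flippable`). Flipping it moves the strip outwards and removes a vertex at level `a d`,
hence not `I₀`; the number of cells based at level `a d` drops, so the process ends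
(`exists_pushed`). A strip along the boundary is forced (`mem_of_pushed`), and cutting it off leaves
a tiling of a smaller box (`shrink_of_pushed`). If `I₀ d = a d`, the central symmetry `x ↦ a - x`
first brings `I₀` to level `0`. With at most one positive side there is only one tiling
(`eq_setOf_inC`).

Two geometric inputs support this. `exists_rhombus_on_side` finds the rhombus beside an edge from a
lift of a displaced midpoint, read through the sign of `det (v_i, ·)`. `isTiling_flip` shows that a
flip yields a tiling: lines along the kernel of the projection cross each half of the cube's
boundary exactly once. -/

noncomputable section

namespace CubeRecurrence

variable {n : ℕ}

/-! ### Cells, their centers and their relative interiors. -/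

namespace Face

theorem mem_toSet {F : Face n} {x : Fin n → ℝ} :
    x ∈ F.toSet ↔ ∀ i, (F.base i : ℝ) ≤ x i ∧ x i ≤ (F.top i : ℝ) := by
  simp only [toSet, Set.mem_Icc, Pi.le_def]
  exact ⟨fun h i => ⟨h.1 i, h.2 i⟩, fun h => ⟨fun i => (h i).1, fun i => (h i).2⟩⟩

theorem top_of_mem {F : Face n} {i : Fin n} (h : i ∈ F.dirs) : F.top i = F.base i + 1 := by
  simp [top, h]

theorem top_of_notMem {F : Face n} {i : Fin n} (h : i ∉ F.dirs) : F.top i = F.base i := by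
  simp [top, h]

theorem base_le_top (F : Face n) : F.base ≤ F.top := fun i => by simp [top]

theorem top_le_base_add_one (F : Face n) (i : Fin n) : F.top i ≤ F.base i + 1 := by
  by_cases h : i ∈ F.dirs
  · rw [top_of_mem h]
  · rw [top_of_notMem h]; omega

theorem IsFaceOf.refl (F : Face n) : F.IsFaceOf F := ⟨le_rfl, le_rfl⟩

theorem IsFaceOf.trans {F G H : Face n} (h : F.IsFaceOf G) (h' : G.IsFaceOf H) : F.IsFaceOf H :=
  ⟨h'.1.trans h.1, h.2.trans h'.2⟩

theorem IsFaceOf.toSet_subset {F G : Face n} (h : F.IsFaceOf G) : F.toSet ⊆ G.toSet := by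
  intro x hx
  rw [mem_toSet] at hx ⊢
  intro i
  have h1 : (G.base i : ℝ) ≤ F.base i := by exact_mod_cast h.1 i
  have h2 : (F.top i : ℝ) ≤ G.top i := by exact_mod_cast h.2 i
  exact ⟨h1.trans (hx i).1, (hx i).2.trans h2⟩

theorem IsFaceOf.dirs_subset {F G : Face n} (h : F.IsFaceOf G) : F.dirs ⊆ G.dirs := by
  intro i hi
  by_contra hG
  have h1 : G.base i ≤ F.base i := h.1 i
  have h2 : F.top i ≤ G.top i := h.2 i
  rw [top_of_mem hi, top_of_notMem hG] at h2
  omega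

theorem IsFaceOf.dim_le {F G : Face n} (h : F.IsFaceOf G) : F.dim ≤ G.dim :=
  Finset.card_le_card h.dirs_subset

@[simp] theorem vertex_base (I : Fin n → ℕ) : (vertex I).base = I := rfl

@[simp] theorem vertex_top (I : Fin n → ℕ) : (vertex I).top = I := by
  funext i; simp [top, vertex]

theorem vertex_isFaceOf {I : Fin n → ℕ} {F : Face n} :
    (vertex I).IsFaceOf F ↔ F.base ≤ I ∧ I ≤ F.top := by
  simp [IsFaceOf]

/-- The center of a cell. -/
def center (F : Face n) : Fin n → ℝ := fun i => ((F.base i : ℝ) + F.top i) / 2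

theorem center_mem (F : Face n) : F.center ∈ F.toSet := by
  rw [mem_toSet]
  intro i
  have : (F.base i : ℝ) ≤ F.top i := by exact_mod_cast F.base_le_top i
  constructor <;> simp only [center] <;> linarith

/-- The point `x` lies in the relative interior of the cell `F`. -/
def RelInt (F : Face n) (x : Fin n → ℝ) : Prop :=
  ∀ i, (F.top i = F.base i ∧ x i = F.base i) ∨ ((F.base i : ℝ) < x i ∧ x i < F.top i)

theorem RelInt.isFaceOf {F G : Face n} {x : Fin n → ℝ} (h : F.RelInt x) (hx : x ∈ G.toSet) :
    F.IsFaceOf G := by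
  rw [mem_toSet] at hx
  refine ⟨fun i => ?_, fun i => ?_⟩
  · rcases h i with ⟨_, h1⟩ | ⟨_, h2⟩
    · have := (hx i).1
      rw [h1] at this
      exact_mod_cast this
    · have h3 := (hx i).1.trans_lt h2
      have h4 : G.base i < F.top i := by exact_mod_cast h3
      have := F.top_le_base_add_one i
      show G.base i ≤ F.base i
      omega
  · rcases h i with ⟨h0, h1⟩ | ⟨h2, _⟩
    · have := (hx i).2
      rw [h1] at this
      rw [h0]
      exact_mod_cast this
    · have h3 := h2.trans_le (hx i).2
      have h4 : F.base i < G.top i := by exact_mod_cast h3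
      have := F.top_le_base_add_one i
      show F.top i ≤ G.top i
      omega

theorem relInt_segment {F : Face n} {x : Fin n → ℝ} (hx : x ∈ F.toSet) {δ : ℝ} (h0 : 0 < δ)
    (h1 : δ ≤ 1) : F.RelInt (x + δ • (F.center - x)) := by
  rw [mem_toSet] at hx
  intro i
  simp only [Pi.add_apply, Pi.smul_apply, Pi.sub_apply, smul_eq_mul, center]
  have h2 := hx i
  by_cases hi : i ∈ F.dirs
  · right
    have h3 : (F.top i : ℝ) = F.base i + 1 := by rw [top_of_mem hi]; push_cast; ring
    rw [h3] at h2 ⊢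
    constructor <;> nlinarith
  · left
    have h3 := top_of_notMem hi
    rw [h3] at h2 ⊢
    have : x i = F.base i := le_antisymm h2.2 h2.1
    exact ⟨rfl, by rw [this]; ring⟩

theorem relInt_center (F : Face n) : F.RelInt F.center := by
  have := relInt_segment F.center_mem one_pos le_rfl
  simpa using this

/-- Centers have integer or half-integer coordinates and the bounds of `G` are integers, so coming
within `1 / 2` of the center forces `G` to span the range of `F` in each coordinate. -/
theorem isFaceOf_of_near_center {F G : Face n} {y : Fin n → ℝ} (hy : y ∈ G.toSet)
    (h : ∀ i, |y i - F.center i| < 1 / 2) : F.IsFaceOf G := by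
  rw [mem_toSet] at hy
  have key : ∀ i, G.base i ≤ F.base i ∧ F.top i ≤ G.top i := by
    intro i
    have h1 := abs_lt.1 (h i)
    have h2 := hy i
    simp only [center] at h1
    by_cases hi : i ∈ F.dirs
    · rw [top_of_mem hi] at h1 ⊢
      push_cast at h1
      have h3 : (G.base i : ℝ) < (F.base i + 1 : ℕ) := by push_cast; linarith
      have h4 : (F.base i : ℝ) < G.top i := by linarith
      have h5 : G.base i < F.base i + 1 := by exact_mod_cast h3
      have h6 : F.base i < G.top i := by exact_mod_cast h4
      omega
    · rw [top_of_notMem hi] at h1 ⊢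
      have h3 : (G.base i : ℝ) < (F.base i + 1 : ℕ) := by push_cast; linarith
      have h4 : (F.base i : ℝ) < (G.top i + 1 : ℕ) := by push_cast; linarith
      have h5 : G.base i < F.base i + 1 := by exact_mod_cast h3
      have h6 : F.base i < G.top i + 1 := by exact_mod_cast h4
      omega
  exact ⟨fun i => (key i).1, fun i => (key i).2⟩

theorem isCompact_toSet (F : Face n) : IsCompact F.toSet := isCompact_Icc

end Face

theorem mem_space {K : Set (Face n)} {x : Fin n → ℝ} : x ∈ space K ↔ ∃ F ∈ K, x ∈ F.toSet := by
  simp [space]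

theorem mem_boxC {a : Fin n → ℕ} {x : Fin n → ℝ} : x ∈ boxC a ↔ ∀ i, 0 ≤ x i ∧ x i ≤ a i := by
  simp only [boxC, Set.mem_Icc, Pi.le_def, Pi.zero_apply]
  exact ⟨fun h i => ⟨h.1 i, h.2 i⟩, fun h => ⟨fun i => (h i).1, fun i => (h i).2⟩⟩

theorem InC.toSet_subset {a : Fin n → ℕ} {F : Face n} (h : InC a F) : F.toSet ⊆ boxC a := by
  intro x hx
  rw [Face.mem_toSet] at hx
  rw [mem_boxC]
  intro i
  have h2 : (F.top i : ℝ) ≤ a i := by exact_mod_cast h i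
  exact ⟨(Nat.cast_nonneg _).trans (hx i).1, (hx i).2.trans h2⟩

theorem finite_inC (a : Fin n → ℕ) : {F : Face n | InC a F}.Finite := by
  have : Set.Finite ((Set.Iic a) ×ˢ (Set.univ : Set (Finset (Fin n)))) :=
    (Set.finite_Iic a).prod Set.finite_univ
  refine (this.image fun p : (Fin n → ℕ) × Finset (Fin n) => (⟨p.1, p.2⟩ : Face n)).subset ?_
  intro F hF
  exact ⟨(F.base, F.dirs), ⟨F.base_le_top.trans hF, trivial⟩, rfl⟩

/-! ### The projection and the determinants of the vectors `v_i`. -/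

section Proj

variable (θ : Fin n → ℝ)

/-- The determinant of the vectors `v_i` and `v_j`. -/
def cr (i j : Fin n) : ℝ := Real.sin (θ j - θ i)

theorem cr_eq (i j : Fin n) :
    cr θ i j = Real.cos (θ i) * Real.sin (θ j) - Real.sin (θ i) * Real.cos (θ j) := by
  rw [cr, Real.sin_sub]; ring

theorem cr_self (i : Fin n) : cr θ i i = 0 := by simp [cr]

theorem cr_swap (i j : Fin n) : cr θ i j = - cr θ j i := by simp only [cr_eq]; ring

theorem proj_add (x y : Fin n → ℝ) : proj θ (x + y) = proj θ x + proj θ y := by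
  simp only [proj, Pi.add_apply, add_smul, Finset.sum_add_distrib]

theorem proj_smul (t : ℝ) (x : Fin n → ℝ) : proj θ (t • x) = t • proj θ x := by
  simp only [proj, Finset.smul_sum, Pi.smul_apply, smul_eq_mul, mul_smul]

theorem proj_neg (x : Fin n → ℝ) : proj θ (-x) = - proj θ x := by
  simpa using proj_smul θ (-1) x

theorem proj_sub (x y : Fin n → ℝ) : proj θ (x - y) = proj θ x - proj θ y := by
  rw [sub_eq_add_neg, proj_add, proj_neg, sub_eq_add_neg]

theorem proj_single (i : Fin n) (t : ℝ) :
    proj θ (Pi.single i t) = t • (Real.cos (θ i), Real.sin (θ i)) := by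
  rw [proj, Finset.sum_eq_single i]
  · simp
  · intro j _ hj; simp [hj]
  · simp

theorem continuous_proj : Continuous (proj θ) := by
  unfold proj; fun_prop

theorem proj_ne_of_single {x : Fin n → ℝ} {i : Fin n} {t : ℝ} (ht : t ≠ 0) :
    proj θ (x + Pi.single i t) ≠ proj θ x := by
  rw [proj_add, proj_single]
  intro h
  have h1 : t • (Real.cos (θ i), Real.sin (θ i)) = 0 := by simpa using h
  rw [Prod.ext_iff] at h1
  simp only [Prod.smul_mk, smul_eq_mul, Prod.fst_zero, Prod.snd_zero, mul_eq_zero, ht,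
    false_or] at h1
  have := Real.sin_sq_add_cos_sq (θ i)
  rw [h1.1, h1.2] at this
  norm_num at this

/-- The functional `x ↦ det (v_i, π x)`. -/
theorem det_proj (i : Fin n) (x : Fin n → ℝ) :
    Real.cos (θ i) * (proj θ x).2 - Real.sin (θ i) * (proj θ x).1 = ∑ m, x m * cr θ i m := by
  simp only [proj, Prod.fst_sum, Prod.snd_sum, Prod.smul_mk, smul_eq_mul, Finset.mul_sum,
    ← Finset.sum_sub_distrib, cr_eq]
  exact Finset.sum_congr rfl fun m _ => by ring

variable {θ}

theorem sum_cr_eq_of_proj_eq {x y : Fin n → ℝ} (h : proj θ x = proj θ y) (i : Fin n) :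
    ∑ m, x m * cr θ i m = ∑ m, y m * cr θ i m := by
  rw [← det_proj, ← det_proj, h]

theorem sum_sub_cr_eq_zero {x y : Fin n → ℝ} (h : proj θ x = proj θ y) (i : Fin n) :
    ∑ m, (x m - y m) * cr θ i m = 0 := by
  simp only [sub_mul, Finset.sum_sub_distrib, sum_cr_eq_of_proj_eq h i, sub_self]

/-- Cramer's rule for three plane vectors. For the directions of a cube it supplies the kernel
direction along which the cube is flipped. -/
theorem proj_cr_relation (i j k : Fin n) :
    proj θ (Pi.single k (cr θ i j) + Pi.single i (cr θ j k) - Pi.single j (cr θ i k)) = 0 := by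
  rw [proj_sub, proj_add, proj_single, proj_single, proj_single]
  simp only [cr_eq]
  ext <;> simp <;> ring

theorem exists_proj_eq {j k : Fin n} (h : cr θ j k ≠ 0) (x : Fin n → ℝ) :
    ∃ s t : ℝ, proj θ (Pi.single j s + Pi.single k t) = proj θ x := by
  set q := proj θ x
  refine ⟨(q.1 * Real.sin (θ k) - q.2 * Real.cos (θ k)) / cr θ j k,
    (q.2 * Real.cos (θ j) - q.1 * Real.sin (θ j)) / cr θ j k, ?_⟩
  rw [proj_add, proj_single, proj_single]
  have h' := cr_eq θ j k
  ext
  · simp only [Prod.smul_mk, smul_eq_mul, Prod.fst_add]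
    rw [div_mul_eq_mul_div, div_mul_eq_mul_div, ← add_div, div_eq_iff h, h']; ring
  · simp only [Prod.smul_mk, smul_eq_mul, Prod.snd_add]
    rw [div_mul_eq_mul_div, div_mul_eq_mul_div, ← add_div, div_eq_iff h, h']; ring

end Proj

/-- The collection `K` of cells is a tiling of the zonogon; compactness makes the projection a
homeomorphism as soon as it is bijective. -/
structure IsTiling (a : Fin n → ℕ) (θ : Fin n → ℝ) (K : Set (Face n)) : Prop where
  inC : ∀ F ∈ K, InC a F
  closed_under_faces : ∀ G ∈ K, ∀ F : Face n, F.IsFaceOf G → F ∈ K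
  dim_le_two : ∀ F ∈ K, F.dim ≤ 2
  injOn : Set.InjOn (proj θ) (space K)
  surj : ∀ x ∈ boxC a, ∃ y ∈ space K, proj θ y = proj θ x

theorem isFaceOf_of_subset {J : Fin n → ℕ} {A B : Finset (Fin n)} (h : A ⊆ B) :
    (⟨J, A⟩ : Face n).IsFaceOf ⟨J, B⟩ := by
  refine ⟨le_rfl, fun m => ?_⟩
  simp only [Face.top]
  by_cases hA : m ∈ A
  · simp [hA, h hA]
  · simp [hA]

theorem isFaceOf_of_subset_add {J : Fin n → ℕ} {A B : Finset (Fin n)} {k : Fin n} (h : A ⊆ B)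
    (hkB : k ∈ B) (hkA : k ∉ A) : (⟨J + Pi.single k 1, A⟩ : Face n).IsFaceOf ⟨J, B⟩ := by
  refine ⟨fun m => by simp, fun m => ?_⟩
  simp only [Face.top, Pi.add_apply]
  by_cases hm : m = k
  · subst hm; simp [hkA, hkB]
  · by_cases hA : m ∈ A
    · simp [hA, h hA, hm]
    · simp [hA, hm]

/-! ### Local structure of a tiling near a cell, an edge and a vertex. -/

namespace IsTiling

variable {a : Fin n → ℕ} {θ : Fin n → ℝ} {K : Set (Face n)}

theorem space_subset (h : IsTiling a θ K) : space K ⊆ boxC a := by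
  intro x hx
  obtain ⟨F, hF, hxF⟩ := mem_space.1 hx
  exact (h.inC F hF).toSet_subset hxF

theorem finite (h : IsTiling a θ K) : K.Finite := (finite_inC a).subset h.inC

theorem isCompact_space (h : IsTiling a θ K) : IsCompact (space K) :=
  h.finite.isCompact_biUnion fun F _ => F.isCompact_toSet

/-- The part of the tiling at distance at least `1 / 2` from the center of `G` is compact, and by
injectivity its image is a closed set missing the image of the center. So nearby points can only
lift near the center, into cells containing `G`. -/
theorem eventually_lift (h : IsTiling a θ K) {G : Face n} (hG : G ∈ K) :
    ∀ᶠ x in nhds G.center, x ∈ boxC a →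
      ∃ F ∈ K, G.IsFaceOf F ∧ ∃ y ∈ F.toSet, proj θ y = proj θ x := by
  have hc : G.center ∈ space K := mem_space.2 ⟨G, hG, G.center_mem⟩
  have hA : IsCompact (space K \ Metric.ball G.center (1 / 2)) :=
    h.isCompact_space.diff Metric.isOpen_ball
  have hclosed : IsClosed (proj θ '' (space K \ Metric.ball G.center (1 / 2))) :=
    (hA.image (continuous_proj θ)).isClosed
  have hnot : proj θ G.center ∉ proj θ '' (space K \ Metric.ball G.center (1 / 2)) := by
    rintro ⟨y, ⟨hy, hy'⟩, he⟩
    rw [h.injOn hy hc he] at hy'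
    exact hy' (Metric.mem_ball_self (by norm_num))
  filter_upwards [(continuous_proj θ).continuousAt.eventually (hclosed.isOpen_compl.mem_nhds hnot)]
    with x hx hxbox
  obtain ⟨y, hy, he⟩ := h.surj x hxbox
  obtain ⟨F, hF, hyF⟩ := mem_space.1 hy
  refine ⟨F, hF, ?_, y, hyF, he⟩
  have hyb : y ∈ Metric.ball G.center (1 / 2) := by
    by_contra hcon
    exact hx ⟨y, ⟨hy, hcon⟩, he⟩
  refine Face.isFaceOf_of_near_center hyF fun i => ?_
  have := (dist_pi_lt_iff (by norm_num)).1 (Metric.mem_ball.1 hyb) i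
  rwa [Real.dist_eq] at this

theorem exists_lift_of_direction (h : IsTiling a θ K) {G : Face n} (hG : G ∈ K) {j : Fin n}
    (hj : j ∉ G.dirs) {σ : ℝ}
    (hσ : (σ = 1 ∧ G.base j < a j) ∨ (σ = -1 ∧ 0 < G.base j)) :
    ∃ ε > 0, ∃ F ∈ K, G.IsFaceOf F ∧
      ∃ y ∈ F.toSet, proj θ y = proj θ (G.center + Pi.single j (σ * ε)) := by
  have hlim : Filter.Tendsto (fun ε : ℝ => G.center + Pi.single j (σ * ε)) (nhds 0)
      (nhds G.center) := by
    have hcont : Continuous fun ε : ℝ => G.center + Pi.single j (σ * ε) :=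
      continuous_const.add ((continuous_single j).comp (continuous_const.mul continuous_id))
    have := hcont.tendsto 0
    simpa using this
  have h1 := (hlim.eventually (h.eventually_lift hG)).filter_mono
    (nhdsWithin_le_nhds (s := Set.Ioi 0))
  have h2 : ∀ᶠ ε : ℝ in nhdsWithin 0 (Set.Ioi 0), ε ∈ Set.Ioo (0 : ℝ) 1 :=
    Ioo_mem_nhdsGT one_pos
  obtain ⟨ε, hε, hε'⟩ := (h1.and h2).exists
  refine ⟨ε, hε'.1, hε ?_⟩
  have hc := (h.inC G hG).toSet_subset G.center_mem
  rw [mem_boxC] at hc ⊢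
  intro m
  by_cases hm : m = j
  · subst hm
    have htop : G.center m = G.base m := by
      simp only [Face.center, Face.top_of_notMem hj]; ring
    simp only [Pi.add_apply, Pi.single_eq_same, htop]
    rcases hσ with ⟨rfl, hlt⟩ | ⟨rfl, hlt⟩
    · have h3 : ((G.base m + 1 : ℕ) : ℝ) ≤ a m := by exact_mod_cast hlt
      push_cast at h3
      have h4 : (0 : ℝ) ≤ G.base m := Nat.cast_nonneg _
      constructor <;> linarith [hε'.1, hε'.2]
    · have h3 : ((1 : ℕ) : ℝ) ≤ G.base m := by exact_mod_cast hlt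
      push_cast at h3
      have h4 := (hc m).2
      rw [htop] at h4
      constructor <;> linarith [hε'.1, hε'.2]
  · simpa [hm] using hc m

/-- Displace the midpoint of the edge by a small multiple of `σ v_j` and lift it to a cell `F`
containing the edge. The functional `det (v_i, ·)` vanishes on the edge direction but not on the
displacement, so `F` has one further direction `k`. The sign in the conclusion records whether `F`
leaves the edge along `+e_k` or `-e_k`. -/
theorem exists_rhombus_on_side (h : IsTiling a θ K) {I : Fin n → ℕ} {i j : Fin n}
    (hE : (⟨I, {i}⟩ : Face n) ∈ K) (hc : cr θ i j ≠ 0) {σ : ℝ}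
    (hσ : (σ = 1 ∧ I j < a j) ∨ (σ = -1 ∧ 0 < I j)) :
    ∃ k, k ≠ i ∧ ((0 < σ * cr θ i j * cr θ i k ∧ (⟨I, {i, k}⟩ : Face n) ∈ K) ∨
      (σ * cr θ i j * cr θ i k < 0 ∧ ∃ J, I = J + Pi.single k 1 ∧ (⟨J, {i, k}⟩ : Face n) ∈ K)) := by
  have hji : j ≠ i := by
    rintro rfl; exact hc (cr_self θ j)
  obtain ⟨ε, hε, F, hF, hGF, y, hy, he⟩ :=
    h.exists_lift_of_direction hE (j := j) (by simpa using hji) hσ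
  have hσ0 : σ ≠ 0 := by rcases hσ with ⟨rfl, _⟩ | ⟨rfl, _⟩ <;> norm_num
  have hsum := sum_sub_cr_eq_zero he i
  have hsum' : ∑ m, (y m - (⟨I, {i}⟩ : Face n).center m) * cr θ i m = σ * ε * cr θ i j := by
    have : ∑ m, (Pi.single j (σ * ε) : Fin n → ℝ) m * cr θ i m = σ * ε * cr θ i j := by
      rw [Finset.sum_eq_single j]
      · simp
      · intro m _ hm; simp [hm]
      · simp
    rw [← this, ← sub_eq_zero, ← Finset.sum_sub_distrib, ← hsum]
    refine Finset.sum_congr rfl fun m _ => ?_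
    simp only [Pi.add_apply]; ring
  rw [Face.mem_toSet] at hy
  have hcm : ∀ m, m ≠ i → (⟨I, {i}⟩ : Face n).center m = I m := by
    intro m hm
    simp only [Face.center]
    rw [Face.top_of_notMem (by simpa using hm)]; ring
  have hi : i ∈ F.dirs := hGF.dirs_subset (by simp)
  have hbase : ∀ m, F.base m ≤ I m := hGF.1
  have htop : ∀ m, (⟨I, {i}⟩ : Face n).top m ≤ F.top m := hGF.2
  have hoff : ∀ m, m ∉ F.dirs → F.base m = I m ∧ y m = I m := by
    intro m hm
    have hmi : m ≠ i := by rintro rfl; exact hm hi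
    have h1 := htop m
    rw [Face.top_of_notMem (by simpa using hmi), Face.top_of_notMem hm] at h1
    have h2 := hbase m
    have h3 : F.base m = I m := le_antisymm h2 h1
    have h4 := hy m
    rw [Face.top_of_notMem hm, h3] at h4
    exact ⟨h3, le_antisymm h4.2 h4.1⟩
  have hne : σ * ε * cr θ i j ≠ 0 := mul_ne_zero (mul_ne_zero hσ0 hε.ne') hc
  obtain ⟨k, hk, hki⟩ : ∃ k ∈ F.dirs, k ≠ i := by
    by_contra hcon
    push Not at hcon
    refine hne ?_
    rw [← hsum']
    refine Finset.sum_eq_zero fun m _ => ?_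
    by_cases hm : m = i
    · rw [hm, cr_self, mul_zero]
    · rw [hcm m hm, (hoff m fun hd => hm (hcon m hd)).2, sub_self, zero_mul]
  have hdirs : F.dirs = {i, k} := by
    symm
    refine Finset.eq_of_subset_of_card_le ?_ ?_
    · intro m hm
      rcases Finset.mem_insert.1 hm with rfl | hm
      · exact hi
      · rw [Finset.mem_singleton.1 hm]; exact hk
    · rw [Finset.card_pair hki.symm]; exact h.dim_le_two F hF
  have hsum'' : (y k - I k) * cr θ i k = σ * ε * cr θ i j := by
    rw [← hsum', Finset.sum_eq_single k]
    · rw [hcm k hki]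
    · intro m _ hm
      by_cases hmi : m = i
      · rw [hmi, cr_self, mul_zero]
      · rw [hcm m hmi, (hoff m (by simp [hdirs, hm, hmi])).2, sub_self, zero_mul]
    · simp
  have hFeq : F = ⟨F.base, {i, k}⟩ := Face.ext rfl hdirs
  have hbi : F.base i = I i := by
    have h1 := htop i
    rw [Face.top_of_mem (by simp), Face.top_of_mem hi] at h1
    have h2 := hbase i
    have h3 : I i + 1 ≤ F.base i + 1 := h1
    omega
  have hyk := hy k
  rw [Face.top_of_mem hk] at hyk
  have hk2 := htop k
  rw [Face.top_of_notMem (by simpa using hki), Face.top_of_mem hk] at hk2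
  have hk3 := hbase k
  have hck : (y k - I k) * cr θ i k ≠ 0 := by rw [hsum'']; exact hne
  -- Multiplying by `cr θ i k` produces a square, so `y k - I k` has the sign of `σ * cr θ i j * cr
  -- θ i k`.
  have hprod : σ * cr θ i j * cr θ i k * ε = (y k - I k) * cr θ i k ^ 2 := by
    linear_combination (- cr θ i k) * hsum''
  have hcrk : 0 < cr θ i k ^ 2 := by
    have := (mul_ne_zero_iff.1 hck).2
    positivity
  have hyne := (mul_ne_zero_iff.1 hck).1
  refine ⟨k, hki, ?_⟩
  rcases hk3.eq_or_lt with hkk | hkk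
  · left
    have hbI : F.base = I := by
      funext m
      by_cases hm : m ∈ F.dirs
      · rw [hdirs] at hm
        rcases Finset.mem_insert.1 hm with rfl | hm
        · exact hbi
        · rw [Finset.mem_singleton.1 hm]; exact hkk
      · exact (hoff m hm).1
    rw [hbI] at hFeq
    refine ⟨?_, hFeq ▸ hF⟩
    have h1 : (I k : ℝ) ≤ y k := by rw [← hkk]; exact hyk.1
    have h2 : 0 < y k - I k := lt_of_le_of_ne (by linarith) hyne.symm
    have h3 : 0 < σ * cr θ i j * cr θ i k * ε := by rw [hprod]; positivity
    exact pos_of_mul_pos_left h3 hε.le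
  · right
    have hk4 : I k = F.base k + 1 := le_antisymm hk2 hkk
    refine ⟨?_, F.base, ?_, hFeq ▸ hF⟩
    · have h1 : y k ≤ I k := by rw [hk4]; exact hyk.2
      have h2 : y k - I k < 0 := lt_of_le_of_ne (by linarith) hyne
      have h3 : σ * cr θ i j * cr θ i k * ε < 0 := by
        rw [hprod]; exact mul_neg_of_neg_of_pos h2 hcrk
      by_contra h4
      exact absurd h3 (not_lt.2 (mul_nonneg (not_lt.1 h4) hε.le))
    · funext m
      by_cases hmk : m = k
      · subst hmk; simp [hk4]
      · simp only [Pi.add_apply, Pi.single_eq_of_ne hmk, add_zero]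
        by_cases hm : m ∈ F.dirs
        · rw [hdirs] at hm
          rcases Finset.mem_insert.1 hm with rfl | hm
          · exact hbi.symm
          · exact absurd (Finset.mem_singleton.1 hm) hmk
        · exact (hoff m hm).1.symm

/-- Consecutive directions turn counterclockwise. -/
def _root_.CubeRecurrence.Positive (θ : Fin n → ℝ) : Prop := ∀ i j, i < j → 0 < cr θ i j

theorem _root_.CubeRecurrence.Positive.ne_zero (hp : Positive θ) {i j : Fin n} (hij : i ≠ j) :
    cr θ i j ≠ 0 := by
  rcases lt_or_gt_of_ne hij with h | h
  · exact (hp i j h).ne'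
  · rw [cr_swap]; exact neg_ne_zero.2 (hp j i h).ne'

theorem _root_.CubeRecurrence.Positive.lt_of_pos (hp : Positive θ) {i j : Fin n}
    (h : 0 < cr θ i j) : i < j := by
  by_contra hcon
  rcases (not_lt.1 hcon).eq_or_lt with rfl | hlt
  · rw [cr_self] at h; exact lt_irrefl _ h
  · rw [cr_swap] at h; linarith [hp j i hlt]

theorem _root_.CubeRecurrence.Positive.neg (hp : Positive θ) {i j : Fin n}
    (h : j < i) : cr θ i j < 0 := by
  rw [cr_swap]; linarith [hp j i h]

theorem _root_.CubeRecurrence.Positive.lt_of_neg (hp : Positive θ) {i j : Fin n}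
    (h : cr θ i j < 0) : j < i := by
  apply hp.lt_of_pos
  rw [cr_swap]; linarith

/-- The edge of `C` at `I` in the direction `i` is mapped to the upper boundary of `P`. -/
def _root_.CubeRecurrence.IsTopEdge (a I : Fin n → ℕ) (i : Fin n) : Prop :=
  (∀ m, i < m → I m = a m) ∧ ∀ m, m < i → I m = 0

/-- Off the upper boundary there is still room in `C` to increase `det (v_i, ·)`: raise a coordinate
after `i` or lower one before `i`. -/
theorem exists_rhombus_above (h : IsTiling a θ K) (hp : Positive θ) {I : Fin n → ℕ} {i : Fin n}
    (hE : (⟨I, {i}⟩ : Face n) ∈ K) (hI : ¬ IsTopEdge a I i) :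
    (∃ k, i < k ∧ (⟨I, {i, k}⟩ : Face n) ∈ K) ∨
      ∃ k, k < i ∧ ∃ J, I = J + Pi.single k 1 ∧ (⟨J, {i, k}⟩ : Face n) ∈ K := by
  have hle : I ≤ a := (Face.base_le_top _).trans (h.inC _ hE)
  obtain ⟨j, σ, hs, hσ⟩ : ∃ j, ∃ σ : ℝ, 0 < σ * cr θ i j ∧
      ((σ = 1 ∧ I j < a j) ∨ (σ = -1 ∧ 0 < I j)) := by
    rw [IsTopEdge, not_and_or] at hI
    push Not at hI
    rcases hI with ⟨j, hj, hne⟩ | ⟨j, hj, hne⟩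
    · exact ⟨j, 1, by rw [one_mul]; exact hp i j hj, Or.inl ⟨rfl, lt_of_le_of_ne (hle j) hne⟩⟩
    · exact ⟨j, -1, by linarith [hp.neg hj], Or.inr ⟨rfl, Nat.pos_of_ne_zero hne⟩⟩
  obtain ⟨k, hk, ⟨h1, h2⟩ | ⟨h1, h2⟩⟩ :=
    h.exists_rhombus_on_side hE (right_ne_zero_of_mul hs.ne') hσ
  · exact Or.inl ⟨k, hp.lt_of_pos (pos_of_mul_pos_right h1 hs.le), h2⟩
  · refine Or.inr ⟨k, hp.lt_of_neg ?_, h2⟩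
    by_contra h4
    exact absurd h1 (not_lt.2 (mul_nonneg hs.le (not_lt.1 h4)))

theorem exists_rhombus_below (h : IsTiling a θ K) (hp : Positive θ) {I : Fin n → ℕ} {i : Fin n}
    (hE : (⟨I, {i}⟩ : Face n) ∈ K) (hI : (∃ m, i < m ∧ 0 < I m) ∨ ∃ m, m < i ∧ I m < a m) :
    (∃ k, k < i ∧ (⟨I, {i, k}⟩ : Face n) ∈ K) ∨
      ∃ k, i < k ∧ ∃ J, I = J + Pi.single k 1 ∧ (⟨J, {i, k}⟩ : Face n) ∈ K := by
  obtain ⟨j, σ, hs, hσ⟩ : ∃ j, ∃ σ : ℝ, σ * cr θ i j < 0 ∧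
      ((σ = 1 ∧ I j < a j) ∨ (σ = -1 ∧ 0 < I j)) := by
    rcases hI with ⟨j, hj, hne⟩ | ⟨j, hj, hne⟩
    · exact ⟨j, -1, by linarith [hp i j hj], Or.inr ⟨rfl, hne⟩⟩
    · exact ⟨j, 1, by rw [one_mul]; exact hp.neg hj, Or.inl ⟨rfl, hne⟩⟩
  obtain ⟨k, hk, ⟨h1, h2⟩ | ⟨h1, h2⟩⟩ :=
    h.exists_rhombus_on_side hE (right_ne_zero_of_mul hs.ne) hσ
  · refine Or.inl ⟨k, hp.lt_of_neg ?_, h2⟩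
    by_contra h4
    exact absurd h1 (not_lt.2 (mul_nonpos_of_nonpos_of_nonneg hs.le (not_lt.1 h4)))
  · refine Or.inr ⟨k, hp.lt_of_pos ?_, h2⟩
    by_contra h4
    exact absurd h1 (not_lt.2 (mul_nonneg_of_nonpos_of_nonpos hs.le (not_lt.1 h4)))

theorem exists_sign {I : Fin n → ℕ} {j : Fin n} (hj : 0 < a j) :
    ∃ σ : ℝ, σ ≠ 0 ∧ ((σ = 1 ∧ I j < a j) ∨ (σ = -1 ∧ 0 < I j)) := by
  by_cases h : I j < a j
  · exact ⟨1, one_ne_zero, Or.inl ⟨rfl, h⟩⟩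
  · exact ⟨-1, by norm_num, Or.inr ⟨rfl, by omega⟩⟩

theorem exists_rhombus_of_edge (h : IsTiling a θ K) (hp : Positive θ)
    (ha : ∃ i j, i ≠ j ∧ 0 < a i ∧ 0 < a j) {I : Fin n → ℕ} {i : Fin n}
    (hE : (⟨I, {i}⟩ : Face n) ∈ K) :
    ∃ G ∈ K, (⟨I, {i}⟩ : Face n).IsFaceOf G ∧ ∃ J, ∃ i' k, i' < k ∧ G = ⟨J, {i', k}⟩ := by
  obtain ⟨j, hji, hj⟩ : ∃ j, i ≠ j ∧ 0 < a j := by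
    obtain ⟨j, k, hjk, hj, hk⟩ := ha
    by_cases hij : i = j
    · exact ⟨k, by rw [hij]; exact hjk, hk⟩
    · exact ⟨j, hij, hj⟩
  obtain ⟨σ, -, hσ⟩ := exists_sign (I := I) hj
  have key : ∀ J k, k ≠ i → ∃ i' k', i' < k' ∧ (⟨J, {i, k}⟩ : Face n) = ⟨J, {i', k'}⟩ := by
    intro J k hk
    rcases lt_or_gt_of_ne hk with hlt | hlt
    · exact ⟨k, i, hlt, by rw [Finset.pair_comm]⟩
    · exact ⟨i, k, hlt, rfl⟩
  obtain ⟨k, hk, ⟨h1, h2⟩ | ⟨h1, J, rfl, h2⟩⟩ := h.exists_rhombus_on_side hE (hp.ne_zero hji) hσ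
  · exact ⟨_, h2, isFaceOf_of_subset (by simp), I, key I k hk⟩
  · exact ⟨_, h2, isFaceOf_of_subset_add (by simp) (by simp) (by simpa using hk), J, key J k hk⟩

/-- Edges have a rhombus beside them. A vertex lies in a larger cell because a displaced image of it
must lift to some cell containing it, and a single point cannot cover that image. -/
theorem exists_rhombus (h : IsTiling a θ K) (hp : Positive θ)
    (ha : ∃ i j, i ≠ j ∧ 0 < a i ∧ 0 < a j) {F : Face n} (hF : F ∈ K) :
    ∃ G ∈ K, F.IsFaceOf G ∧ ∃ J, ∃ i k, i < k ∧ G = ⟨J, {i, k}⟩ := by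
  have hpos : ∀ F ∈ K, F.dirs.Nonempty →
      ∃ G ∈ K, F.IsFaceOf G ∧ ∃ J, ∃ i k, i < k ∧ G = ⟨J, {i, k}⟩ := by
    intro F hF hne
    have hd := h.dim_le_two F hF
    have : F.dirs.card = 1 ∨ F.dirs.card = 2 := by
      have := hne.card_pos
      rw [Face.dim] at hd
      omega
    rcases this with h1 | h2
    · obtain ⟨i, hi⟩ := Finset.card_eq_one.1 h1
      have hFeq : F = ⟨F.base, {i}⟩ := Face.ext rfl hi
      rw [hFeq] at hF ⊢
      exact h.exists_rhombus_of_edge hp ha hF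
    · obtain ⟨i, k, hik, hd⟩ := Finset.card_eq_two.1 h2
      refine ⟨F, hF, Face.IsFaceOf.refl F, F.base, ?_⟩
      rcases lt_or_gt_of_ne hik with hlt | hlt
      · exact ⟨i, k, hlt, Face.ext rfl hd⟩
      · exact ⟨k, i, hlt, Face.ext rfl (by rw [hd, Finset.pair_comm])⟩
  rcases F.dirs.eq_empty_or_nonempty with hemp | hne
  · obtain ⟨j, -, -, hj, -⟩ := ha
    obtain ⟨σ, hσ0, hσ⟩ := exists_sign (I := F.base) hj
    obtain ⟨ε, hε, G, hG, hFG, y, hy, he⟩ :=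
      h.exists_lift_of_direction hF (j := j) (by simp [hemp]) hσ
    rcases G.dirs.eq_empty_or_nonempty with hG0 | hG0
    · exfalso
      have hFe : F.base = G.base := by
        funext m
        have h1 : G.base m ≤ F.base m := hFG.1 m
        have h2 : F.top m ≤ G.top m := hFG.2 m
        rw [Face.top_of_notMem (by simp [hemp]), Face.top_of_notMem (by simp [hG0])] at h2
        omega
      have hyF : y = F.center := by
        funext m
        rw [Face.mem_toSet] at hy
        have h1 := hy m
        rw [Face.top_of_notMem (by simp [hG0])] at h1
        simp only [Face.center]
        rw [Face.top_of_notMem (by simp [hemp]), hFe]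
        linarith
      rw [hyF] at he
      exact proj_ne_of_single θ (mul_ne_zero hσ0 hε.ne') he.symm
    · obtain ⟨G', hG', hGG', hr⟩ := hpos G hG hG0
      exact ⟨G', hG', hFG.trans hGG', hr⟩
  · exact hpos F hF hne

theorem mem_of_center_mem_space (h : IsTiling a θ K) {F : Face n} (hF : F.center ∈ space K) :
    F ∈ K := by
  obtain ⟨G, hG, hFG⟩ := mem_space.1 hF
  exact h.closed_under_faces G hG F (F.relInt_center.isFaceOf hFG)

theorem _root_.CubeRecurrence.eq_of_proj_eq_of_eq_off {x y : Fin n → ℝ} {i : Fin n}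
    (hxy : proj θ x = proj θ y) (h : ∀ m, m ≠ i → x m = y m) : x = y := by
  have hx : x = y + Pi.single i (x i - y i) := by
    funext m
    by_cases hm : m = i
    · subst hm; simp
    · simp [hm, h m hm]
  by_contra hne
  have ht : x i - y i ≠ 0 := by
    intro h0
    rw [h0, Pi.single_zero, add_zero] at hx
    exact hne hx
  refine proj_ne_of_single θ ht (x := y) (i := i) ?_
  rw [← hx, hxy]

/-- `IsTopEdge` is the condition for maximizing `det (v_i, ·)` over `C` coordinate by coordinate:
full after `i`, zero before `i`. -/
theorem _root_.CubeRecurrence.IsTopEdge.term_nonpos (hp : Positive θ) {I : Fin n → ℕ} {i : Fin n}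
    (hI : IsTopEdge a I i) {y : Fin n → ℝ} (hy : y ∈ boxC a) (m : Fin n) :
    (y m - I m) * cr θ i m ≤ 0 := by
  rw [mem_boxC] at hy
  rcases lt_trichotomy m i with hm | rfl | hm
  · rw [hI.2 m hm]
    refine mul_nonpos_of_nonneg_of_nonpos ?_ (hp.neg hm).le
    have := (hy m).1
    push_cast; linarith
  · rw [cr_self, mul_zero]
  · rw [hI.1 m hm]
    refine mul_nonpos_of_nonpos_of_nonneg ?_ (hp i m hm).le
    have := (hy m).2
    linarith

/-- A lift of the midpoint attains the maximum of `det (v_i, ·)`, so it agrees with the midpoint off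
coordinate `i`; on such a line the projection is injective. -/
theorem mem_of_isTopEdge (h : IsTiling a θ K) (hp : Positive θ) {I : Fin n → ℕ} {i : Fin n}
    (hC : InC a ⟨I, {i}⟩) (hI : IsTopEdge a I i) : (⟨I, {i}⟩ : Face n) ∈ K := by
  apply h.mem_of_center_mem_space
  obtain ⟨y, hy, he⟩ := h.surj _ (hC.toSet_subset (Face.center_mem _))
  have hcm : ∀ m, m ≠ i → (⟨I, {i}⟩ : Face n).center m = I m := by
    intro m hm
    simp only [Face.center]
    rw [Face.top_of_notMem (by simpa using hm)]; ring
  have hsum := sum_sub_cr_eq_zero he i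
  have hterm : ∀ m, (y m - (⟨I, {i}⟩ : Face n).center m) * cr θ i m ≤ 0 := by
    intro m
    by_cases hm : m = i
    · rw [hm, cr_self, mul_zero]
    · rw [hcm m hm]; exact hI.term_nonpos hp (h.space_subset hy) m
  have hzero := (Finset.sum_eq_zero_iff_of_nonpos fun m _ => hterm m).1 hsum
  have : y = (⟨I, {i}⟩ : Face n).center := by
    refine eq_of_proj_eq_of_eq_off (i := i) he fun m hm => ?_
    have h1 := hzero m (Finset.mem_univ m)
    rcases mul_eq_zero.1 h1 with h2 | h2
    · linarith
    · exact absurd h2 (hp.ne_zero hm.symm)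
  rw [← this]; exact hy

/-- Here `C` is a point or a segment, on which the projection is injective, so surjectivity forces
every cell. -/
theorem eq_setOf_inC (h : IsTiling a θ K) (ha : ¬ ∃ i j, i ≠ j ∧ 0 < a i ∧ 0 < a j) :
    K = {F | InC a F} := by
  refine Set.Subset.antisymm h.inC fun F hF => ?_
  apply h.mem_of_center_mem_space
  have hc := hF.toSet_subset F.center_mem
  obtain ⟨y, hy, he⟩ := h.surj _ hc
  have hyb := h.space_subset hy
  rw [mem_boxC] at hc hyb
  have hz : ∀ m, a m = 0 → y m = F.center m := by
    intro m hm
    have h1 := hc m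
    have h2 := hyb m
    rw [hm] at h1 h2
    push_cast at h1 h2
    linarith
  have : y = F.center := by
    by_cases hex : ∃ i, 0 < a i
    · obtain ⟨i, hi⟩ := hex
      refine eq_of_proj_eq_of_eq_off (i := i) he fun m hm => hz m ?_
      by_contra hne
      exact ha ⟨m, i, hm, Nat.pos_of_ne_zero hne, hi⟩
    · push Not at hex
      exact funext fun m => hz m (Nat.le_zero.1 (hex m))
  rw [← this]; exact hy

/-- For `i < j < d` both coefficients have the sign of `t`, so `v_d` points into the sector spanned
by `v_j` and `-v_i`. -/
theorem proj_up {i j d : Fin n} (h : cr θ i j ≠ 0) (t : ℝ) :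
    proj θ (Pi.single j (t * cr θ i d / cr θ i j) - Pi.single i (t * cr θ j d / cr θ i j)) =
      proj θ (Pi.single d t) := by
  have h1 := congrArg (fun q => (t / cr θ i j) • q) (proj_cr_relation (θ := θ) i j d)
  simp only [smul_zero, ← proj_smul, smul_sub, smul_add, ← Pi.single_smul, smul_eq_mul] at h1
  rw [eq_comm, ← sub_eq_zero, ← proj_sub, ← h1]
  congr 1
  rw [div_mul_cancel₀ _ h]
  have e1 : t / cr θ i j * cr θ j d = t * cr θ j d / cr θ i j := by ring
  have e2 : t / cr θ i j * cr θ i d = t * cr θ i d / cr θ i j := by ring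
  rw [e1, e2]
  abel

theorem mem_rhombus {J : Fin n → ℕ} {i j : Fin n} (hij : i ≠ j) {s t : ℝ} (hs : 0 ≤ s)
    (hs1 : s ≤ 1) (ht : 0 ≤ t) (ht1 : t ≤ 1) :
    (fun m => (((J + Pi.single i 1 : Fin n → ℕ) m : ℕ) : ℝ)) + (Pi.single j t - Pi.single i s) ∈
      (⟨J, {i, j}⟩ : Face n).toSet := by
  rw [Face.mem_toSet]
  intro m
  by_cases hmi : m = i
  · subst hmi
    rw [Face.top_of_mem (by simp)]
    simp only [Pi.add_apply, Pi.sub_apply, Pi.single_eq_same, Pi.single_eq_of_ne hij]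
    push_cast
    constructor <;> linarith
  · by_cases hmj : m = j
    · subst hmj
      rw [Face.top_of_mem (by simp)]
      simp only [Pi.add_apply, Pi.sub_apply, Pi.single_eq_same, Pi.single_eq_of_ne hmi]
      push_cast
      constructor <;> linarith
    · rw [Face.top_of_notMem (by simp [hmi, hmj])]
      simp [hmi, hmj]

/-- Starting at the common vertex, a short segment along `v_d` enters both rhombi. Injectivity makes
its two lifts equal, and their nonzero coordinates reveal the directions. -/
theorem rhombus_unique_of_bottom_vertex (h : IsTiling a θ K) (hp : Positive θ)
    {J J' : Fin n → ℕ} {i j i' j' d : Fin n} (hij : i < j) (hjd : j < d) (hij' : i' < j')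
    (hjd' : j' < d) (hF : (⟨J, {i, j}⟩ : Face n) ∈ K) (hF' : (⟨J', {i', j'}⟩ : Face n) ∈ K)
    (hJ : J + Pi.single i 1 = J' + Pi.single i' 1) : i = i' ∧ j = j' := by
  set α := cr θ j d / cr θ i j
  set β := cr θ i d / cr θ i j
  set α' := cr θ j' d / cr θ i' j'
  set β' := cr θ i' d / cr θ i' j'
  have hα : 0 < α := div_pos (hp _ _ hjd) (hp _ _ hij)
  have hβ : 0 < β := div_pos (hp _ _ (hij.trans hjd)) (hp _ _ hij)
  have hα' : 0 < α' := div_pos (hp _ _ hjd') (hp _ _ hij')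
  have hβ' : 0 < β' := div_pos (hp _ _ (hij'.trans hjd')) (hp _ _ hij')
  -- Small enough that all four displacements are at most `1` and both lifts stay in their rhombi.
  set ε := 1 / (α + β + α' + β')
  have hε : 0 < ε := by positivity
  have hle : ∀ x, x ≤ α + β + α' + β' → ε * x ≤ 1 := by
    intro x hx
    have : ε * x ≤ ε * (α + β + α' + β') := mul_le_mul_of_nonneg_left hx hε.le
    rwa [one_div_mul_cancel (by positivity)] at this
  set w : Fin n → ℝ := fun m => (((J + Pi.single i 1 : Fin n → ℕ) m : ℕ) : ℝ)
  have h1 : w + (Pi.single j (ε * β) - Pi.single i (ε * α)) ∈ space K :=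
    mem_space.2 ⟨_, hF, mem_rhombus hij.ne (by positivity) (hle _ (by linarith)) (by positivity)
      (hle _ (by linarith))⟩
  have h2 : w + (Pi.single j' (ε * β') - Pi.single i' (ε * α')) ∈ space K := by
    refine mem_space.2 ⟨_, hF', ?_⟩
    simp only [w, hJ]
    exact mem_rhombus hij'.ne (by positivity) (hle _ (by linarith)) (by positivity)
      (hle _ (by linarith))
  have h3 : w + (Pi.single j (ε * β) - Pi.single i (ε * α)) =
      w + (Pi.single j' (ε * β') - Pi.single i' (ε * α')) := by
    refine h.injOn h1 h2 ?_
    rw [proj_add, proj_add]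
    have e1 := proj_up (θ := θ) (d := d) (hp _ _ hij).ne' ε
    have e2 := proj_up (θ := θ) (d := d) (hp _ _ hij').ne' ε
    rw [mul_div_assoc, mul_div_assoc] at e1 e2
    rw [e1, e2]
  have h4 := add_left_cancel h3
  have h5 := congrFun h4 i
  have h6 := congrFun h4 j
  have hεα := mul_pos hε hα
  have hεβ := mul_pos hε hβ
  have hεα' := mul_pos hε hα'
  have hεβ' := mul_pos hε hβ'
  simp only [Pi.sub_apply, Pi.single_apply, if_neg hij.ne, if_neg hij.ne', if_true] at h5 h6
  constructor
  · by_contra hne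
    rw [if_neg hne] at h5
    split_ifs at h5 <;> linarith
  · by_contra hne
    rw [if_neg hne] at h6
    split_ifs at h6 <;> linarith

end IsTiling

/-! ### Exchanging the two halves of the boundary of a cube. -/

/-- The cells of dimension at most two of the cube `Q` which contain the vertex `w`. -/
def star (Q : Face n) (w : Fin n → ℕ) : Set (Face n) :=
  {F | F.IsFaceOf Q ∧ F.dim ≤ 2 ∧ (Face.vertex w).IsFaceOf F}

/-- The three dimensional cube `Q`, with opposite vertices `w` and `w'`, and a vector `u` in the
kernel of the projection pointing from `w'` towards `w`. -/
structure FlipData (θ : Fin n → ℝ) (Q : Face n) (w w' : Fin n → ℕ) (u : Fin n → ℝ) : Prop where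
  card : Q.dirs.card = 3
  ker : proj θ u = 0
  opp : ∀ m, (w m = Q.base m ∧ w' m = Q.top m) ∨ (w m = Q.top m ∧ w' m = Q.base m)
  dir : ∀ m ∈ Q.dirs, (w m = Q.top m ∧ 0 < u m) ∨ (w m = Q.base m ∧ u m < 0)
  dir_off : ∀ m, m ∉ Q.dirs → u m = 0

namespace FlipData

variable {θ : Fin n → ℝ} {Q : Face n} {w w' : Fin n → ℕ} {u : Fin n → ℝ}

theorem symm (h : FlipData θ Q w w' u) : FlipData θ Q w' w (-u) where
  card := h.card
  ker := by rw [proj_neg, h.ker, neg_zero]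
  opp m := by rcases h.opp m with ⟨h1, h2⟩ | ⟨h1, h2⟩ <;> simp [h1, h2]
  dir m hm := by
    have htop := Face.top_of_mem hm
    rcases h.dir m hm with ⟨h1, h2⟩ | ⟨h1, h2⟩ <;> rcases h.opp m with ⟨h3, h4⟩ | ⟨h3, h4⟩
    · omega
    · exact Or.inr ⟨h4, by simpa using h2⟩
    · exact Or.inl ⟨h4, by simpa using h2⟩
    · omega
  dir_off m hm := by simp [h.dir_off m hm]

/-- A facet of `Q` containing the vertex `w`. -/
def facet (Q : Face n) (w : Fin n → ℕ) (m : Fin n) : Face n :=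
  ⟨Function.update Q.base m (w m), Q.dirs.erase m⟩

theorem facet_base_self (Q : Face n) (w : Fin n → ℕ) (m : Fin n) : (facet Q w m).base m = w m := by
  simp [facet]

theorem facet_base_of_ne (Q : Face n) (w : Fin n → ℕ) {m i : Fin n} (hi : i ≠ m) :
    (facet Q w m).base i = Q.base i := by simp [facet, hi]

theorem facet_top_self (Q : Face n) (w : Fin n → ℕ) (m : Fin n) : (facet Q w m).top m = w m := by
  simp [facet, Face.top]

theorem facet_top_of_ne (Q : Face n) (w : Fin n → ℕ) {m i : Fin n} (hi : i ≠ m) :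
    (facet Q w m).top i = Q.top i := by simp [facet, Face.top, hi]

theorem mem_facet {x : Fin n → ℝ} {m : Fin n} (hx : x ∈ Q.toSet) (hm : x m = w m) :
    x ∈ (facet Q w m).toSet := by
  rw [Face.mem_toSet] at hx ⊢
  intro i
  by_cases hi : i = m
  · subst hi; rw [facet_base_self, facet_top_self, hm]; exact ⟨le_rfl, le_rfl⟩
  · rw [facet_base_of_ne Q w hi, facet_top_of_ne Q w hi]; exact hx i

theorem vertex_mem (h : FlipData θ Q w w' u) (m : Fin n) : Q.base m ≤ w m ∧ w m ≤ Q.top m := by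
  have : Q.base m ≤ Q.top m := Q.base_le_top m
  rcases h.opp m with ⟨h1, _⟩ | ⟨h1, _⟩ <;> omega

theorem facet_mem_star (h : FlipData θ Q w w' u) {m : Fin n} (hm : m ∈ Q.dirs) :
    facet Q w m ∈ star Q w := by
  refine ⟨⟨fun i => ?_, fun i => ?_⟩, ?_, ?_⟩
  · by_cases hi : i = m
    · subst hi; rw [facet_base_self]; exact (h.vertex_mem i).1
    · rw [facet_base_of_ne Q w hi]
  · by_cases hi : i = m
    · subst hi; rw [facet_top_self]; exact (h.vertex_mem i).2
    · rw [facet_top_of_ne Q w hi]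
  · simp [Face.dim, facet, Finset.card_erase_of_mem hm, h.card]
  · rw [Face.vertex_isFaceOf]
    refine ⟨fun i => ?_, fun i => ?_⟩
    · by_cases hi : i = m
      · subst hi; rw [facet_base_self]
      · rw [facet_base_of_ne Q w hi]; exact (h.vertex_mem i).1
    · by_cases hi : i = m
      · subst hi; rw [facet_top_self]
      · rw [facet_top_of_ne Q w hi]; exact (h.vertex_mem i).2

/-- Every cell in the star of `w` is contained in a facet through `w`. -/
theorem exists_eq_of_mem_star (h : FlipData θ Q w w' u) {F : Face n} (hF : F ∈ star Q w)
    {x : Fin n → ℝ} (hx : x ∈ F.toSet) : x ∈ Q.toSet ∧ ∃ m ∈ Q.dirs, x m = w m := by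
  obtain ⟨hFQ, hdim, hw⟩ := hF
  refine ⟨hFQ.toSet_subset hx, ?_⟩
  obtain ⟨m, hm, hmF⟩ : ∃ m ∈ Q.dirs, m ∉ F.dirs := by
    by_contra hcon
    push Not at hcon
    have := Finset.card_le_card (fun i hi => hcon i hi : Q.dirs ⊆ F.dirs)
    rw [h.card] at this
    rw [Face.dim] at hdim
    omega
  refine ⟨m, hm, ?_⟩
  rw [Face.vertex_isFaceOf] at hw
  have h1 : F.base m ≤ w m := hw.1 m
  have h2 : w m ≤ F.top m := hw.2 m
  rw [Face.mem_toSet] at hx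
  have h3 := hx m
  rw [Face.top_of_notMem hmF] at h2 h3
  rw [le_antisymm h2 h1]
  exact le_antisymm h3.2 h3.1

theorem mem_space_star (h : FlipData θ Q w w' u) {x : Fin n → ℝ} :
    x ∈ space (star Q w) ↔ x ∈ Q.toSet ∧ ∃ m ∈ Q.dirs, x m = w m := by
  rw [mem_space]
  constructor
  · rintro ⟨F, hF, hx⟩
    exact h.exists_eq_of_mem_star hF hx
  · rintro ⟨hx, m, hm, hxm⟩
    exact ⟨_, h.facet_mem_star hm, mem_facet hx hxm⟩

/-- The signed distance to the facets through `w`, along `u`. -/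
theorem div_nonneg_of_mem (h : FlipData θ Q w w' u) {x : Fin n → ℝ} (hx : x ∈ Q.toSet)
    {m : Fin n} (hm : m ∈ Q.dirs) : 0 ≤ (w m - x m) / u m := by
  rw [Face.mem_toSet] at hx
  rcases h.dir m hm with ⟨h1, h2⟩ | ⟨h1, h2⟩
  · rw [h1]; exact div_nonneg (by linarith [(hx m).2]) h2.le
  · rw [h1]; exact div_nonneg_of_nonpos (by linarith [(hx m).1]) h2.le

/-- The smallest ratio `(w m - x m) / u m` is the first time at which the ray along `u` hits a facet
through `w`; until then no coordinate leaves `Q`. -/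
theorem exists_exit (h : FlipData θ Q w w' u) {x : Fin n → ℝ} (hx : x ∈ Q.toSet) :
    ∃ t : ℝ, 0 ≤ t ∧ x + t • u ∈ space (star Q w) := by
  obtain ⟨m, hm, hmin⟩ := Finset.exists_min_image Q.dirs (fun m => (w m - x m) / u m)
    (Finset.card_pos.1 (by rw [h.card]; norm_num))
  refine ⟨(w m - x m) / u m, h.div_nonneg_of_mem hx hm, h.mem_space_star.2 ⟨?_, m, hm, ?_⟩⟩
  · have h0 := h.div_nonneg_of_mem hx hm
    rw [Face.mem_toSet] at hx ⊢
    intro i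
    simp only [Pi.add_apply, Pi.smul_apply, smul_eq_mul]
    by_cases hi : i ∈ Q.dirs
    · have h1 := hmin i hi
      have htop : (Q.top i : ℝ) = Q.base i + 1 := by rw [Face.top_of_mem hi]; push_cast; ring
      have h2 := hx i
      rcases h.dir i hi with ⟨h3, h4⟩ | ⟨h3, h4⟩
      · have h5 := (le_div_iff₀ h4).1 h1
        rw [h3] at h5
        have h6 := mul_nonneg h0 h4.le
        constructor <;> linarith
      · have h5 := (le_div_iff_of_neg h4).1 h1
        rw [h3] at h5
        have h6 := mul_nonpos_of_nonneg_of_nonpos h0 h4.le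
        constructor <;> linarith
    · rw [h.dir_off i hi, mul_zero, add_zero]; exact hx i
  · have hu : u m ≠ 0 := by
      rcases h.dir m hm with ⟨_, h2⟩ | ⟨_, h2⟩
      · exact h2.ne'
      · exact h2.ne
    simp only [Pi.add_apply, Pi.smul_apply, smul_eq_mul]
    rw [div_mul_cancel₀ _ hu]; ring

/-- In each direction of `Q`, `w` takes the extreme value towards which `u` points, so any motion
along `u` from a facet through `w` leaves `Q`. -/
theorem eq_zero_of_mem (h : FlipData θ Q w w' u) {x : Fin n → ℝ} (hx : x ∈ space (star Q w))
    {t : ℝ} (ht : 0 ≤ t) (hxt : x + t • u ∈ Q.toSet) : t = 0 := by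
  obtain ⟨-, m, hm, hxm⟩ := h.mem_space_star.1 hx
  rw [Face.mem_toSet] at hxt
  have h1 := hxt m
  simp only [Pi.add_apply, Pi.smul_apply, smul_eq_mul, hxm] at h1
  by_contra hne
  have htp : 0 < t := lt_of_le_of_ne ht (Ne.symm hne)
  rcases h.dir m hm with ⟨h2, h3⟩ | ⟨h2, h3⟩
  · rw [h2] at h1
    have := mul_pos htp h3
    linarith [h1.2]
  · rw [h2] at h1
    have := mul_neg_of_pos_of_neg htp h3
    linarith [h1.1]

theorem proj_add_smul (h : FlipData θ Q w w' u) (x : Fin n → ℝ) (t : ℝ) :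
    proj θ (x + t • u) = proj θ x := by
  rw [proj_add, proj_smul, h.ker, smul_zero, add_zero]

/-- Moving along the kernel from a point of `Q` off the facets through `w`, one reaches the
interior of `Q`. -/
theorem exists_interior (h : FlipData θ Q w w' u) {x : Fin n → ℝ} (hx : x ∈ Q.toSet)
    (hxw : x ∉ space (star Q w)) : ∃ τ : ℝ, ∀ m ∈ Q.dirs,
      (Q.base m : ℝ) < (x + τ • u) m ∧ (x + τ • u) m < Q.top m := by
  have hne : ∀ m ∈ Q.dirs, x m ≠ w m := fun m hm he => hxw (h.mem_space_star.2 ⟨hx, m, hm, he⟩)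
  have hev : ∀ m ∈ Q.dirs, ∀ᶠ τ in nhdsWithin (0 : ℝ) (Set.Ioi 0),
      (Q.base m : ℝ) < (x + τ • u) m ∧ (x + τ • u) m < Q.top m := by
    intro m hm
    have htend : Filter.Tendsto (fun τ : ℝ => (x + τ • u) m) (nhdsWithin (0 : ℝ) (Set.Ioi 0))
        (nhds (x m)) := by
      have : Continuous fun τ : ℝ => (x + τ • u) m := by
        simp only [Pi.add_apply, Pi.smul_apply, smul_eq_mul]; fun_prop
      have h0 := this.tendsto 0
      simp only [zero_smul, add_zero] at h0
      exact h0.mono_left nhdsWithin_le_nhds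
    have hxm := (Face.mem_toSet.1 hx) m
    have hpos : ∀ᶠ τ in nhdsWithin (0 : ℝ) (Set.Ioi 0), 0 < τ := self_mem_nhdsWithin
    rcases h.dir m hm with ⟨h1, h2⟩ | ⟨h1, h2⟩
    · have hlt : x m < Q.top m := lt_of_le_of_ne hxm.2 (by rw [← h1]; exact hne m hm)
      filter_upwards [htend.eventually_lt_const hlt, hpos] with τ h3 h4
      refine ⟨?_, h3⟩
      simp only [Pi.add_apply, Pi.smul_apply, smul_eq_mul]
      linarith [mul_pos h4 h2, hxm.1]
    · have hlt : (Q.base m : ℝ) < x m := lt_of_le_of_ne hxm.1 (by rw [← h1]; exact (hne m hm).symm)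
      filter_upwards [htend.eventually_const_lt hlt, hpos] with τ h3 h4
      refine ⟨h3, ?_⟩
      simp only [Pi.add_apply, Pi.smul_apply, smul_eq_mul]
      linarith [mul_neg_of_pos_of_neg h4 h2, hxm.2]
  exact ((Finset.eventually_all Q.dirs).2 hev).exists

/-- The points near the projection of such a point belong to the projection of `Q`. -/
theorem eventually_mem (h : FlipData θ Q w w' u) (hp : Positive θ) {x : Fin n → ℝ}
    (hx : x ∈ Q.toSet) (hxw : x ∉ space (star Q w)) (c : Fin n → ℝ) :
    ∀ᶠ δ in nhdsWithin (0 : ℝ) (Set.Ioi 0), ∃ z ∈ Q.toSet, proj θ z = proj θ (x + δ • c) := by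
  obtain ⟨j, hj, k, hk, hjk⟩ := Finset.one_lt_card.1 (by rw [h.card]; norm_num : 1 < Q.dirs.card)
  -- Two directions of the cube already span the plane, so the image of `c` is also that of a vector
  -- `r` inside the span of the cube. Small multiples of `r` keep an interior point in `Q`.
  obtain ⟨s, t, hst⟩ := exists_proj_eq (hp.ne_zero hjk) c
  obtain ⟨τ, hτ⟩ := h.exists_interior hx hxw
  set r : Fin n → ℝ := Pi.single j s + Pi.single k t
  have hev : ∀ m ∈ Q.dirs, ∀ᶠ δ in nhdsWithin (0 : ℝ) (Set.Ioi 0),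
      (Q.base m : ℝ) < (x + τ • u + δ • r) m ∧ (x + τ • u + δ • r) m < Q.top m := by
    intro m hm
    have htend : Filter.Tendsto (fun δ : ℝ => (x + τ • u + δ • r) m)
        (nhdsWithin (0 : ℝ) (Set.Ioi 0)) (nhds ((x + τ • u) m)) := by
      have : Continuous fun δ : ℝ => (x + τ • u + δ • r) m := by
        simp only [Pi.add_apply, Pi.smul_apply, smul_eq_mul]; fun_prop
      have h0 := this.tendsto 0
      simp only [zero_smul, add_zero] at h0
      exact h0.mono_left nhdsWithin_le_nhds
    exact (htend.eventually_const_lt (hτ m hm).1).and (htend.eventually_lt_const (hτ m hm).2)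
  filter_upwards [(Finset.eventually_all Q.dirs).2 hev] with δ hδ
  refine ⟨x + τ • u + δ • r, Face.mem_toSet.2 fun m => ?_, ?_⟩
  · by_cases hm : m ∈ Q.dirs
    · exact ⟨(hδ m hm).1.le, (hδ m hm).2.le⟩
    · have hmj : m ≠ j := by rintro rfl; exact hm hj
      have hmk : m ≠ k := by rintro rfl; exact hm hk
      have h1 := Face.mem_toSet.1 hx m
      simpa [h.dir_off m hm, r, hmj, hmk] using h1
  · rw [proj_add, h.proj_add_smul, proj_smul, hst, proj_add, proj_smul]

variable {a : Fin n → ℕ} {K : Set (Face n)}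

theorem space_star_subset (hs : star Q w' ⊆ K) : space (star Q w') ⊆ space K := by
  intro x hx
  obtain ⟨F, hF, hxF⟩ := mem_space.1 hx
  exact mem_space.2 ⟨F, hs hF, hxF⟩

/-- A cell of a tiling containing the star of `w'` belongs to that star if it meets the
complement of the star of `w` in the cube. -/
theorem mem_star_of_mem (h : FlipData θ Q w w' u) (hp : Positive θ) (hK : IsTiling a θ K)
    (hs : star Q w' ⊆ K) {F : Face n} (hF : F ∈ K) {x : Fin n → ℝ} (hxF : x ∈ F.toSet)
    (hx : x ∈ Q.toSet) (hxw : x ∉ space (star Q w)) : F ∈ star Q w' := by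
  have hle : ∀ᶠ δ in nhdsWithin (0 : ℝ) (Set.Ioi 0), δ ∈ Set.Ioo (0 : ℝ) 1 :=
    Ioo_mem_nhdsGT one_pos
  -- Move `x` slightly towards the center of `F`. The image still lies under `Q`, hence lifts into
  -- the star of `w'`; injectivity identifies that lift with the moved point, which is interior to
  -- `F`.
  obtain ⟨δ, ⟨z, hz, hze⟩, hδ⟩ := ((h.eventually_mem hp hx hxw (F.center - x)).and hle).exists
  have hrel := Face.relInt_segment hxF hδ.1 hδ.2.le
  obtain ⟨t, ht, hzt⟩ := h.symm.exists_exit hz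
  have hmem : x + δ • (F.center - x) ∈ F.toSet := by
    rw [Face.mem_toSet]
    intro i
    have := F.base_le_top i
    rcases hrel i with ⟨h1, h2⟩ | ⟨h1, h2⟩
    · rw [h1, h2]; exact ⟨le_rfl, le_rfl⟩
    · exact ⟨h1.le, h2.le⟩
  have heq : z + t • (-u) = x + δ • (F.center - x) := by
    refine hK.injOn (space_star_subset hs hzt) (mem_space.2 ⟨F, hF, hmem⟩) ?_
    rw [h.symm.proj_add_smul, hze]
  rw [heq] at hzt
  obtain ⟨G, hG, hzG⟩ := mem_space.1 hzt
  have hFG := hrel.isFaceOf hzG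
  have hFQ := hFG.trans hG.1
  refine ⟨hFQ, hK.dim_le_two F hF, Face.vertex_isFaceOf.2 ?_⟩
  -- If `F` missed `w'` in a direction of `Q`, it would be flat there at the value of `w`, putting
  -- `x` on a facet through `w`.
  have key : ∀ i, F.base i ≤ w' i ∧ w' i ≤ F.top i := by
    intro i
    have hb : Q.base i ≤ F.base i := hFQ.1 i
    have ht' : F.top i ≤ Q.top i := hFQ.2 i
    have hbt : F.base i ≤ F.top i := F.base_le_top i
    by_cases hi : i ∈ Q.dirs
    · have htop := Face.top_of_mem hi
      have hne : x i ≠ w i := fun he => hxw (h.mem_space_star.2 ⟨hx, i, hi, he⟩)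
      have hxi := (Face.mem_toSet.1 hxF) i
      rcases h.opp i with ⟨h1, h2⟩ | ⟨h1, h2⟩
      · have : F.top i ≠ Q.base i := by
          intro he
          apply hne
          rw [he] at hxi
          have h3 : (Q.base i : ℝ) ≤ F.base i := by exact_mod_cast hb
          rw [h1]; linarith
        omega
      · have : F.base i ≠ Q.top i := by
          intro he
          apply hne
          rw [he] at hxi
          have h3 : (F.top i : ℝ) ≤ Q.top i := by exact_mod_cast ht'
          rw [h1]; linarith
        omega
    · have htop := Face.top_of_notMem hi
      rcases h.opp i with ⟨h1, h2⟩ | ⟨h1, h2⟩ <;> omega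
  exact ⟨fun i => (key i).1, fun i => (key i).2⟩

theorem vertex_mem_toSet {F : Face n} {v : Fin n → ℕ} (hv : (Face.vertex v).IsFaceOf F) :
    (fun i => (v i : ℝ)) ∈ F.toSet := by
  apply hv.toSet_subset
  rw [Face.mem_toSet]
  intro i
  simp

theorem opp_notMem (h : FlipData θ Q w w' u) : (fun i => (w' i : ℝ)) ∉ space (star Q w) := by
  rw [h.mem_space_star]
  rintro ⟨-, m, hm, he⟩
  have he' : w' m = w m := by exact_mod_cast he
  have := Face.top_of_mem hm
  rcases h.opp m with ⟨h1, h2⟩ | ⟨h1, h2⟩ <;> omega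

/-- A common cell would contain `w`. The half through `w'` already covers the image of `w`, so
injectivity would place `w` on a facet through the opposite vertex `w'`. -/
theorem disjoint (h : FlipData θ Q w w' u) (hK : IsTiling a θ K) (hs : star Q w' ⊆ K) :
    Disjoint K (star Q w) := by
  rw [Set.disjoint_left]
  intro F hF hFw
  have hw := vertex_mem_toSet hFw.2.2
  have hwQ := hFw.1.toSet_subset hw
  obtain ⟨t, ht, hwt⟩ := h.symm.exists_exit hwQ
  have heq := hK.injOn (space_star_subset hs hwt) (mem_space.2 ⟨F, hF, hw⟩)
    (h.symm.proj_add_smul _ _)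
  rw [heq] at hwt
  exact h.symm.opp_notMem hwt

/-- Replacing one half of the boundary of a cube by the other half yields a tiling. -/
theorem isTiling_flip (h : FlipData θ Q w w' u) (hp : Positive θ) (hK : IsTiling a θ K)
    (hs : star Q w' ⊆ K) (hQ : InC a Q) : IsTiling a θ (K \ star Q w' ∪ star Q w) where
  inC F hF := by
    rcases hF with hF | hF
    · exact hK.inC F hF.1
    · exact hF.1.2.trans hQ
  dim_le_two F hF := by
    rcases hF with hF | hF
    · exact hK.dim_le_two F hF.1
    · exact hF.2.1
  closed_under_faces F hF G hGF := by
    rcases hF with hF | hF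
    · left
      refine ⟨hK.closed_under_faces F hF.1 G hGF, fun hG => hF.2 ?_⟩
      have hw := vertex_mem_toSet hG.2.2
      exact h.mem_star_of_mem hp hK hs hF.1 (hGF.toSet_subset hw) (hG.1.toSet_subset hw)
        h.opp_notMem
    · by_cases hG : (Face.vertex w).IsFaceOf G
      · exact Or.inr ⟨hGF.trans hF.1, hGF.dim_le.trans hF.2.1, hG⟩
      · left
        have hGQ := hGF.trans hF.1
        constructor
        -- A face of `Q` missing `w` is pinned to the value of `w'` in some direction, so it lies in
        -- a facet of the old half.
        · obtain ⟨m, hm, hmG⟩ : ∃ m ∈ Q.dirs, G.base m = w' m ∧ G.top m = w' m := by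
            rw [Face.vertex_isFaceOf] at hG
            by_contra hcon
            push Not at hcon
            have key : ∀ i, G.base i ≤ w i ∧ w i ≤ G.top i := by
              intro i
              have hb : Q.base i ≤ G.base i := hGQ.1 i
              have ht' : G.top i ≤ Q.top i := hGQ.2 i
              have hbt : G.base i ≤ G.top i := G.base_le_top i
              by_cases hi : i ∈ Q.dirs
              · have htop := Face.top_of_mem hi
                have := hcon i hi
                rcases h.opp i with ⟨h1, h2⟩ | ⟨h1, h2⟩ <;> omega
              · have htop := Face.top_of_notMem hi
                rcases h.opp i with ⟨h1, h2⟩ | ⟨h1, h2⟩ <;> omega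
            exact hG ⟨fun i => (key i).1, fun i => (key i).2⟩
          refine hK.closed_under_faces _ (hs (h.symm.facet_mem_star hm)) G ⟨fun i => ?_, fun i => ?_⟩
          · by_cases hi : i = m
            · subst hi; rw [facet_base_self]; exact hmG.1.ge
            · rw [facet_base_of_ne Q w' hi]; exact hGQ.1 i
          · by_cases hi : i = m
            · subst hi; rw [facet_top_self]; exact hmG.2.le
            · rw [facet_top_of_ne Q w' hi]; exact hGQ.2 i
        · intro hG'
          have hw := hGF.toSet_subset (vertex_mem_toSet hG'.2.2)
          exact h.opp_notMem (mem_space.2 ⟨F, hF, hw⟩)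
  injOn := by
    -- Slide `y` back along `-u` to the old half; injectivity of `K` makes the result equal to `x`.
    -- Since `F` was kept, `x` also lies on the new half, so the slide has length zero.
    have hmixed : ∀ F ∈ K \ star Q w', ∀ x ∈ F.toSet, ∀ y ∈ space (star Q w),
        proj θ x = proj θ y → x = y := by
      intro F hF x hx y hy hxy
      have hyQ := (h.mem_space_star.1 hy).1
      obtain ⟨t, ht, hyt⟩ := h.symm.exists_exit hyQ
      have heq : y + t • (-u) = x := by
        refine hK.injOn (space_star_subset hs hyt) (mem_space.2 ⟨F, hF.1, hx⟩) ?_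
        rw [h.symm.proj_add_smul, hxy]
      have hxQ : x ∈ Q.toSet := by
        rw [← heq]; exact (h.symm.mem_space_star.1 hyt).1
      by_cases hxw : x ∈ space (star Q w)
      · have hy' : y = x + t • u := by rw [← heq]; simp
        have ht0 := h.eq_zero_of_mem hxw ht (by rw [← hy']; exact hyQ)
        rw [hy', ht0, zero_smul, add_zero]
      · exact absurd (h.mem_star_of_mem hp hK hs hF.1 hx hxQ hxw) hF.2
    have hstar : ∀ x ∈ space (star Q w), ∀ y ∈ space (star Q w), proj θ x = proj θ y → x = y := by
      intro x hx y hy hxy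
      have hxQ := (h.mem_space_star.1 hx).1
      have hyQ := (h.mem_space_star.1 hy).1
      obtain ⟨s, hs0, hxs⟩ := h.symm.exists_exit hxQ
      obtain ⟨t, ht0, hyt⟩ := h.symm.exists_exit hyQ
      have heq : x + s • (-u) = y + t • (-u) := by
        refine hK.injOn (space_star_subset hs hxs) (space_star_subset hs hyt) ?_
        rw [h.symm.proj_add_smul, h.symm.proj_add_smul, hxy]
      have h1 : y = x + (t - s) • u := by
        rw [smul_neg, smul_neg] at heq
        rw [sub_smul, add_sub, eq_sub_iff_add_eq, ← sub_eq_zero]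
        have := sub_eq_zero.2 heq
        rw [← neg_eq_zero, ← this]; abel
      have h2 : x = y + (s - t) • u := by
        rw [h1, add_assoc, ← add_smul]; simp
      rcases le_total s t with hst | hst
      · have := h.eq_zero_of_mem hx (sub_nonneg.2 hst) (by rw [← h1]; exact hyQ)
        rw [h1, this, zero_smul, add_zero]
      · have := h.eq_zero_of_mem hy (sub_nonneg.2 hst) (by rw [← h2]; exact hxQ)
        rw [h2, this, zero_smul, add_zero]
    intro x hx y hy hxy
    obtain ⟨F, hF, hxF⟩ := mem_space.1 hx
    obtain ⟨G, hG, hyG⟩ := mem_space.1 hy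
    rcases hF with hF | hF <;> rcases hG with hG | hG
    · exact hK.injOn (mem_space.2 ⟨F, hF.1, hxF⟩) (mem_space.2 ⟨G, hG.1, hyG⟩) hxy
    · exact hmixed F hF x hxF y (mem_space.2 ⟨G, hG, hyG⟩) hxy
    · exact (hmixed G hG y hyG x (mem_space.2 ⟨F, hF, hxF⟩) hxy.symm).symm
    · exact hstar x (mem_space.2 ⟨F, hF, hxF⟩) y (mem_space.2 ⟨G, hG, hyG⟩) hxy
  surj x hx := by
    obtain ⟨y, hy, hxy⟩ := hK.surj x hx
    obtain ⟨F, hF, hyF⟩ := mem_space.1 hy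
    by_cases hFs : F ∈ star Q w'
    · obtain ⟨t, -, hyt⟩ := h.exists_exit (hFs.1.toSet_subset hyF)
      obtain ⟨G, hG, hyG⟩ := mem_space.1 hyt
      exact ⟨_, mem_space.2 ⟨G, Or.inr hG, hyG⟩, by rw [h.proj_add_smul, hxy]⟩
    · exact ⟨y, mem_space.2 ⟨F, Or.inl ⟨hF, hFs⟩, hyF⟩, hxy⟩

end FlipData

/-! ### Flips as steps between collections of cells. -/

variable {a : Fin n → ℕ} {θ : Fin n → ℝ} {K : Set (Face n)}

/-- The vertex shared by the bottom faces of the cube at `I`. -/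
def botVertex (I : Fin n → ℕ) (k : Fin n) : Fin n → ℕ := I + Pi.single k 1

/-- The vertex shared by the top faces of the cube at `I`. -/
def topVertex (I : Fin n → ℕ) (j l : Fin n) : Fin n → ℕ := I + Pi.single j 1 + Pi.single l 1

/-- The linear relation between `v_j`, `v_k`, `v_l` has signs `-`, `+`, `-`, so the kernel vector
points from `I + e_j + e_l` towards `I + e_k`. -/
theorem flipData_cube (hp : Positive θ) (I : Fin n → ℕ) {j k l : Fin n} (hjk : j < k)
    (hkl : k < l) : ∃ u, FlipData θ (cube I j k l) (botVertex I k) (topVertex I j l) u := by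
  have hjl := hjk.trans hkl
  refine ⟨_, ?_, proj_cr_relation j l k, ?_, ?_, ?_⟩
  · exact Finset.card_eq_three.2 ⟨j, k, l, hjk.ne, hjl.ne, hkl.ne, rfl⟩
  · intro m
    simp only [botVertex, topVertex, cube, Face.top, Pi.add_apply, Pi.single_apply,
      Finset.mem_insert, Finset.mem_singleton]
    by_cases h1 : m = j
    · subst h1; simp [hjk.ne, hjl.ne]
    · by_cases h2 : m = k
      · subst h2; simp [hkl.ne, h1]
      · by_cases h3 : m = l
        · subst h3; simp [h1, h2]
        · simp [h1, h2, h3]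
  · intro m hm
    simp only [cube, Finset.mem_insert, Finset.mem_singleton] at hm
    simp only [botVertex, cube, Face.top, Pi.add_apply, Pi.sub_apply, Pi.single_apply]
    rcases hm with rfl | rfl | rfl
    · right
      simp only [if_neg hjk.ne, if_neg hjl.ne, if_true]
      have := hp.neg hkl
      constructor
      · simp
      · linarith
    · left
      simp only [if_neg hkl.ne, if_neg hjk.ne', if_true]
      have := hp _ _ hjl
      constructor
      · simp
      · linarith
    · right
      simp only [if_neg hkl.ne', if_neg hjl.ne', if_true]
      have := hp _ _ hjk
      constructor
      · simp
      · linarith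
  · intro m hm
    simp only [cube, Finset.mem_insert, Finset.mem_singleton, not_or] at hm
    simp [hm.1, hm.2.1, hm.2.2]

/-- A flip between collections of cells which does not remove the vertex `I₀`. -/
def Step (a I₀ : Fin n → ℕ) (K K' : Set (Face n)) : Prop :=
  ∃ (I : Fin n → ℕ) (j k l : Fin n), j < k ∧ k < l ∧ InC a (cube I j k l) ∧
    ((star (cube I j k l) (topVertex I j l) ⊆ K ∧
        K' = K \ star (cube I j k l) (topVertex I j l) ∪ star (cube I j k l) (botVertex I k) ∧
        I₀ ≠ topVertex I j l) ∨
      (star (cube I j k l) (botVertex I k) ⊆ K ∧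
        K' = K \ star (cube I j k l) (botVertex I k) ∪ star (cube I j k l) (topVertex I j l) ∧
        I₀ ≠ botVertex I k))

theorem IsTiling.step {I₀ : Fin n → ℕ} {K' : Set (Face n)} (hK : IsTiling a θ K)
    (hp : Positive θ) (h : Step a I₀ K K') : IsTiling a θ K' := by
  obtain ⟨I, j, k, l, hjk, hkl, hC, h⟩ := h
  obtain ⟨u, hu⟩ := flipData_cube hp I hjk hkl
  rcases h with ⟨hs, rfl, -⟩ | ⟨hs, rfl, -⟩
  · exact hu.isTiling_flip hp hK hs hC
  · exact hu.symm.isTiling_flip hp hK hs hC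

theorem FlipData.star_subset {Q : Face n} {w w' : Fin n → ℕ} {u : Fin n → ℝ}
    (h : FlipData θ Q w w' u) (hK : IsTiling a θ K) (hf : ∀ m ∈ Q.dirs, facet Q w m ∈ K) :
    star Q w ⊆ K := by
  rintro F ⟨hFQ, hdim, hw⟩
  obtain ⟨m, hm, hmF⟩ : ∃ m ∈ Q.dirs, m ∉ F.dirs := by
    by_contra hcon
    push Not at hcon
    have := Finset.card_le_card (fun i hi => hcon i hi : Q.dirs ⊆ F.dirs)
    rw [h.card] at this
    rw [Face.dim] at hdim
    omega
  rw [Face.vertex_isFaceOf] at hw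
  have h1 : F.base m ≤ w m := hw.1 m
  have h2 : w m ≤ F.top m := hw.2 m
  have h3 := Face.top_of_notMem hmF
  refine hK.closed_under_faces _ (hf m hm) F ⟨fun i => ?_, fun i => ?_⟩
  · by_cases hi : i = m
    · subst hi
      rw [facet_base_self]
      show w i ≤ F.base i
      omega
    · rw [facet_base_of_ne Q w hi]; exact hFQ.1 i
  · by_cases hi : i = m
    · subst hi
      rw [facet_top_self]
      show F.top i ≤ w i
      omega
    · rw [facet_top_of_ne Q w hi]; exact hFQ.2 i

/-! ### Pushing the last strip to the upper boundary. -/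

namespace IsTiling

theorem base_lt_of_mem_dirs (hK : IsTiling a θ K) {F : Face n} (hF : F ∈ K) {m : Fin n}
    (hm : m ∈ F.dirs) : F.base m < a m := by
  have : F.top m ≤ a m := hK.inC F hF m
  rw [Face.top_of_mem hm] at this
  omega

theorem le_of_mem_dirs (hK : IsTiling a θ K) {d : Fin n} (hd : ∀ m, d < m → a m = 0)
    {F : Face n} (hF : F ∈ K) {m : Fin n} (hm : m ∈ F.dirs) : m ≤ d := by
  by_contra hcon
  have := hK.base_lt_of_mem_dirs hF hm
  rw [hd m (not_le.1 hcon)] at this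
  omega

theorem lt_of_mem_dirs (hK : IsTiling a θ K) {d : Fin n} (hd : ∀ m, d < m → a m = 0)
    {F : Face n} (hF : F ∈ K) (hFd : F.base d = a d) {m : Fin n} (hm : m ∈ F.dirs) : m < d := by
  refine lt_of_le_of_ne (hK.le_of_mem_dirs hd hF hm) ?_
  rintro rfl
  exact (hK.base_lt_of_mem_dirs hF hm).ne hFd

/-- A rhombus on the upper side of the last strip whose lower left edge lies on the strip. -/
theorem exists_rhombus_on_strip (hK : IsTiling a θ K) (hp : Positive θ) {d : Fin n}
    (hd : ∀ m, d < m → a m = 0) (had : 0 < a d) {I : Fin n → ℕ} {i₀ : Fin n} (hId : I d = a d)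
    (hE : (⟨I, {i₀}⟩ : Face n) ∈ K) (hI : ¬ IsTopEdge a I i₀) :
    ∃ B i j, i < j ∧ j < d ∧ B d + 1 = a d ∧ (⟨B + Pi.single d 1, {i, j}⟩ : Face n) ∈ K ∧
      (⟨B, {i, d}⟩ : Face n) ∈ K := by
  set S : Set ((Fin n → ℕ) × Fin n × Fin n) := {p | p.2.1 < p.2.2 ∧ p.2.2 < d ∧ p.1 d = a d ∧
    (⟨p.1, {p.2.1, p.2.2}⟩ : Face n) ∈ K}
  have hS : S.Nonempty := by
    rcases hK.exists_rhombus_above hp hE hI with ⟨k, hk, hF⟩ | ⟨k, hk, J, rfl, hF⟩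
    · exact ⟨(I, i₀, k), hk, hK.lt_of_mem_dirs hd hF hId (by simp), hId, hF⟩
    · have hkd : k < d := lt_of_lt_of_le hk (hK.le_of_mem_dirs hd hF (by simp))
      have hJd : J d = a d := by simpa [hkd.ne'] using hId
      rw [Finset.pair_comm] at hF
      exact ⟨(J, k, i₀), hk, hK.lt_of_mem_dirs hd hF hJd (by simp), hJd, hF⟩
  -- Descend through the rhombi beyond the strip, always crossing the edge at `J` in the smaller
  -- direction `i`. A step that does not reach the strip lowers one of `∑ J`, `i` and keeps the
  -- other.
  obtain ⟨⟨J, i, j⟩, ⟨hij, hjd, hJd, hF⟩, hmin⟩ :=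
    (measure fun p : (Fin n → ℕ) × Fin n × Fin n => (∑ m, p.1 m) * (n + 1) + p.2.1).wf.has_min S hS
  simp only at hij hjd hJd hF
  have hE' : (⟨J, {i}⟩ : Face n) ∈ K :=
    hK.closed_under_faces _ hF _ (isFaceOf_of_subset (by simp))
  rcases hK.exists_rhombus_below hp hE' (Or.inl ⟨d, hij.trans hjd, by omega⟩) with
    ⟨k, hk, hG⟩ | ⟨k, hk, J', rfl, hG⟩
  · exfalso
    rw [Finset.pair_comm] at hG
    refine hmin (J, k, i) ⟨hk, hij.trans hjd, hJd, hG⟩ ?_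
    show (∑ m, J m) * (n + 1) + (k : ℕ) < (∑ m, J m) * (n + 1) + (i : ℕ)
    have : (k : ℕ) < i := hk
    omega
  · by_cases hkd : k = d
    · subst hkd
      exact ⟨J', i, j, hij, hjd, by simpa using hJd, hF, hG⟩
    · exfalso
      have hJd' : J' d = a d := by simpa [Ne.symm hkd] using hJd
      refine hmin (J', i, k) ⟨hk, hK.lt_of_mem_dirs hd hG hJd' (by simp), hJd', hG⟩ ?_
      show (∑ m, J' m) * (n + 1) + (i : ℕ) <
        (∑ m, (J' + Pi.single k 1 : Fin n → ℕ) m) * (n + 1) + (i : ℕ)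
      have : ∑ m, (J' + Pi.single k 1 : Fin n → ℕ) m = ∑ m, J' m + 1 := by
        simp [Finset.sum_add_distrib]
      rw [this, add_mul]
      omega

/-- Among the strip rhombi that carry a rhombus on their upper edge as in `exists_rhombus_on_strip`,
take the one farthest along the strip, that is with `∑ B` maximal. Maximality controls the next
strip rhombus and supplies the third top face of the cube. -/
theorem exists_flippable (hK : IsTiling a θ K) (hp : Positive θ) {d : Fin n}
    (hd : ∀ m, d < m → a m = 0) (had : 0 < a d) {I : Fin n → ℕ} {i₀ : Fin n} (hId : I d = a d)
    (hE : (⟨I, {i₀}⟩ : Face n) ∈ K) (hI : ¬ IsTopEdge a I i₀) :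
    ∃ B i j, i < j ∧ j < d ∧ B d + 1 = a d ∧ InC a (cube B i j d) ∧
      star (cube B i j d) (topVertex B i d) ⊆ K := by
  set S : Set ((Fin n → ℕ) × Fin n × Fin n) := {p | p.2.1 < p.2.2 ∧ p.2.2 < d ∧ p.1 d + 1 = a d ∧
    (⟨p.1 + Pi.single d 1, {p.2.1, p.2.2}⟩ : Face n) ∈ K ∧ (⟨p.1, {p.2.1, d}⟩ : Face n) ∈ K}
  have hS : S.Nonempty := by
    obtain ⟨B, i, j, h⟩ := hK.exists_rhombus_on_strip hp hd had hId hE hI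
    exact ⟨(B, i, j), h⟩
  obtain ⟨⟨B, i, j⟩, ⟨hij, hjd, hBd, hF, hG⟩, hmin⟩ :=
    (measure fun p : (Fin n → ℕ) × Fin n × Fin n => ∑ m, a m - ∑ m, p.1 m).wf.has_min S hS
  simp only at hij hjd hBd hF hG
  have hid := hij.trans hjd
  have hBj : B j < a j := by
    have := hK.base_lt_of_mem_dirs hF (m := j) (by simp)
    simpa [hjd.ne] using this
  have hBi : B i < a i := hK.base_lt_of_mem_dirs hG (m := i) (by simp)
  have hV : (⟨B + Pi.single i 1, {d}⟩ : Face n) ∈ K :=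
    hK.closed_under_faces _ hG _ (isFaceOf_of_subset_add (by simp) (by simp) (by simpa using hid.ne))
  obtain ⟨k, hkd, hG'⟩ : ∃ k, k < d ∧ (⟨B + Pi.single i 1, {k, d}⟩ : Face n) ∈ K := by
    rcases hK.exists_rhombus_below hp hV (Or.inr ⟨j, hjd, by simpa [hij.ne'] using hBj⟩) with
      ⟨k, hk, hH⟩ | ⟨k, hk, J', -, hH⟩
    · exact ⟨k, hk, by rwa [Finset.pair_comm]⟩
    · exact absurd (hK.le_of_mem_dirs hd hH (m := k) (by simp)) (not_le.2 hk)
  have hE' : (⟨B + Pi.single i 1 + Pi.single d 1, {k}⟩ : Face n) ∈ K :=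
    hK.closed_under_faces _ hG' _
      (isFaceOf_of_subset_add (by simp) (by simp) (by simpa using hkd.ne'))
  -- The base vertex has a positive coordinate `i` and a non-maximal coordinate `j > i`, which no
  -- edge of the upper boundary allows.
  have hnot : ¬ IsTopEdge a (B + Pi.single i 1 + Pi.single d 1) k := by
    rintro ⟨h1, h2⟩
    have hki : k ≤ i := by
      by_contra hcon
      have := h2 i (not_le.1 hcon)
      simp at this
    have := h1 j (hki.trans_lt hij)
    simp only [Pi.add_apply, Pi.single_eq_of_ne hij.ne', Pi.single_eq_of_ne hjd.ne] at this
    omega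
  have hswap : B + Pi.single i 1 + Pi.single d 1 = B + Pi.single d 1 + Pi.single i 1 :=
    add_right_comm _ _ _
  have hH : (⟨B + Pi.single i 1, {j, d}⟩ : Face n) ∈ K := by
    -- A rhombus based at this edge's vertex contradicts maximality. Otherwise the rhombus above
    -- shares the vertex `B + e_i + e_d` with the first one and must coincide with it, so `k = j`.
    rcases hK.exists_rhombus_above hp hE' hnot with ⟨k', hk', hH⟩ | ⟨k', hk', J', hJ', hH⟩
    · exfalso
      have hk'd : k' < d := hK.lt_of_mem_dirs hd hH (by simpa [hid.ne'] using hBd) (by simp)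
      refine hmin (B + Pi.single i 1, k, k')
        ⟨hk', hk'd, by simpa [hid.ne'] using hBd, hH, hG'⟩ ?_
      show ∑ m, a m - ∑ m, (B + Pi.single i 1 : Fin n → ℕ) m < ∑ m, a m - ∑ m, B m
      have h1 : ∑ m, (B + Pi.single i 1 : Fin n → ℕ) m = ∑ m, B m + 1 := by
        simp [Finset.sum_add_distrib]
      have h2 : ∑ m, B m < ∑ m, a m := by
        refine Finset.sum_lt_sum (fun m _ => ?_) ⟨i, Finset.mem_univ i, hBi⟩
        exact (Face.base_le_top _ m).trans (hK.inC _ hG m)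
      rw [h1]
      omega
    · rw [Finset.pair_comm] at hH
      obtain ⟨-, rfl⟩ := hK.rhombus_unique_of_bottom_vertex hp hij hjd hk' hkd hF hH
        (by rw [← hJ', hswap])
      exact hG'
  obtain ⟨u, hu⟩ := flipData_cube hp B hij hjd
  refine ⟨B, i, j, hij, hjd, hBd, ?_, ?_⟩
  · intro m
    have h1 : B m ≤ a m := (Face.base_le_top _ m).trans (hK.inC _ hG m)
    simp only [cube, Face.top, Finset.mem_insert, Finset.mem_singleton]
    split_ifs with h2
    · rcases h2 with rfl | rfl | rfl <;> omega
    · omega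
  · refine hu.symm.star_subset hK fun m hm => ?_
    simp only [cube, Finset.mem_insert, Finset.mem_singleton] at hm
    rcases hm with rfl | rfl | rfl
    · convert hH using 1
      refine Face.ext ?_ ?_
      · funext x
        by_cases hx : x = m
        · subst hx; simp [FlipData.facet, cube, topVertex, hid.ne]
        · simp [FlipData.facet, cube, hx]
      · ext x
        simp only [FlipData.facet, cube, Finset.mem_erase, Finset.mem_insert, Finset.mem_singleton]
        have := hij.ne'
        have := hid.ne'
        constructor
        · rintro ⟨h1, h2⟩; tauto
        · rintro (rfl | rfl) <;> tauto
    · convert hG using 1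
      refine Face.ext ?_ ?_
      · funext x
        by_cases hx : x = m
        · subst hx; simp [FlipData.facet, cube, topVertex, hij.ne', hjd.ne]
        · simp [FlipData.facet, cube, hx]
      · ext x
        simp only [FlipData.facet, cube, Finset.mem_erase, Finset.mem_insert, Finset.mem_singleton]
        have := hij.ne
        have := hjd.ne'
        constructor
        · rintro ⟨h1, h2⟩; tauto
        · rintro (rfl | rfl) <;> tauto
    · convert hF using 1
      refine Face.ext ?_ ?_
      · funext x
        by_cases hx : x = m
        · subst hx; simp [FlipData.facet, cube, topVertex, hid.ne']
        · simp [FlipData.facet, cube, hx]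
      · ext x
        simp only [FlipData.facet, cube, Finset.mem_erase, Finset.mem_insert, Finset.mem_singleton]
        have := hid.ne
        have := hjd.ne
        constructor
        · rintro ⟨h1, h2⟩; tauto
        · rintro (rfl | rfl) <;> tauto

/-- The last strip in the direction `d` runs along the upper boundary of `P`. -/
def _root_.CubeRecurrence.Pushed (a : Fin n → ℕ) (d : Fin n) (K : Set (Face n)) : Prop :=
  ∀ (I : Fin n → ℕ) (i : Fin n), I d = a d → (⟨I, {i}⟩ : Face n) ∈ K → IsTopEdge a I i

/-- Each flip removes a vertex at level `a d`, which is not `I₀`, and inserts only cells containing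
`B + e_j`, whose base is below that level. So the number of cells based at level `a d` decreases. -/
theorem exists_pushed (hp : Positive θ) {d : Fin n} (hd : ∀ m, d < m → a m = 0) (had : 0 < a d)
    {I₀ : Fin n → ℕ} (hI₀ : I₀ d < a d) (N : ℕ) : ∀ K : Set (Face n), IsTiling a θ K →
      {F ∈ K | F.base d = a d}.ncard ≤ N →
      ∃ K', Relation.ReflTransGen (Step a I₀) K K' ∧ IsTiling a θ K' ∧ Pushed a d K' := by
  induction N with
  | zero =>
    intro K hK hcard
    refine ⟨K, Relation.ReflTransGen.refl, hK, fun I i hI hE => ?_⟩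
    have hfin : {F ∈ K | F.base d = a d}.Finite := hK.finite.subset fun F hF => hF.1
    rw [Nat.le_zero, Set.ncard_eq_zero hfin] at hcard
    have : (⟨I, {i}⟩ : Face n) ∈ {F ∈ K | F.base d = a d} := ⟨hE, hI⟩
    rw [hcard] at this
    exact this.elim
  | succ N ih =>
    intro K hK hcard
    by_cases hpush : Pushed a d K
    · exact ⟨K, Relation.ReflTransGen.refl, hK, hpush⟩
    · unfold Pushed at hpush
      push Not at hpush
      obtain ⟨I, i₀, hI, hE, hnot⟩ := hpush
      obtain ⟨B, i, j, hij, hjd, hBd, hC, hs⟩ := hK.exists_flippable hp hd had hI hE hnot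
      have hid := hij.trans hjd
      have htop : topVertex B i d d = a d := by simp [topVertex, hid.ne', hBd]
      have hstep : Step a I₀ K
          (K \ star (cube B i j d) (topVertex B i d) ∪ star (cube B i j d) (botVertex B j)) :=
        ⟨B, i, j, d, hij, hjd, hC, Or.inl ⟨hs, rfl, fun he => by
          rw [he, htop] at hI₀; exact lt_irrefl _ hI₀⟩⟩
      have hbot : ∀ F ∈ star (cube B i j d) (botVertex B j), F.base d ≠ a d := by
        intro F hF he
        have h1 : F.base d ≤ botVertex B j d := (Face.vertex_isFaceOf.1 hF.2.2).1 d
        simp only [botVertex, Pi.add_apply, Pi.single_eq_of_ne hjd.ne'] at h1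
        omega
      have hv : Face.vertex (topVertex B i d) ∈ star (cube B i j d) (topVertex B i d) := by
        obtain ⟨u, hu⟩ := flipData_cube hp B hij hjd
        refine ⟨Face.vertex_isFaceOf.2 ⟨fun m => (hu.symm.vertex_mem m).1,
          fun m => (hu.symm.vertex_mem m).2⟩, ?_, Face.IsFaceOf.refl _⟩
        simp [Face.dim, Face.vertex]
      have hlt : {F ∈ K \ star (cube B i j d) (topVertex B i d) ∪
          star (cube B i j d) (botVertex B j) | F.base d = a d}.ncard <
          {F ∈ K | F.base d = a d}.ncard := by
        refine Set.ncard_lt_ncard ?_ (hK.finite.subset fun F hF => hF.1)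
        refine Set.ssubset_iff_exists.2 ⟨?_, Face.vertex (topVertex B i d), ⟨hs hv, htop⟩, ?_⟩
        · rintro F ⟨hF | hF, he⟩
          · exact ⟨hF.1, he⟩
          · exact absurd he (hbot F hF)
        · rintro ⟨hF | hF, he⟩
          · exact hF.2 hv
          · exact hbot _ hF he
      obtain ⟨K', h1, h2, h3⟩ := ih _ (hK.step hp hstep) (by omega)
      exact ⟨K', Relation.ReflTransGen.head hstep h1, h2, h3⟩

end IsTiling

/-! ### Cutting off a strip that lies along the upper boundary. -/

/-- The box obtained from `C` by removing the last layer in the direction `d`. -/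
def shrink (a : Fin n → ℕ) (d : Fin n) : Fin n → ℕ := Function.update a d (a d - 1)

theorem shrink_self (a : Fin n → ℕ) (d : Fin n) : shrink a d d = a d - 1 := by simp [shrink]

theorem shrink_of_ne (a : Fin n → ℕ) {d m : Fin n} (h : m ≠ d) : shrink a d m = a m := by
  simp [shrink, h]

theorem shrink_le (a : Fin n → ℕ) (d : Fin n) : shrink a d ≤ a := by
  intro m
  by_cases h : m = d
  · subst h; rw [shrink_self]; exact Nat.sub_le _ _
  · rw [shrink_of_ne a h]

theorem le_shrink_of_le {I : Fin n → ℕ} {d : Fin n} (h : I ≤ a) (hd : I d < a d) :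
    I ≤ shrink a d := by
  intro m
  by_cases hm : m = d
  · subst hm; rw [shrink_self]; exact Nat.le_sub_one_of_lt hd
  · rw [shrink_of_ne a hm]; exact h m

theorem top_eq_of_not_inC {F : Face n} {d : Fin n} (h : InC a F) (h' : ¬ InC (shrink a d) F) :
    F.top d = a d := by
  by_contra hne
  exact h' (le_shrink_of_le h (lt_of_le_of_ne (h d) hne))

namespace IsTiling

/-- A rhombus based at level `a d` with directions `i < k` would have its edge in direction `i` on
the upper boundary, leaving no room in direction `k`. So every rhombus reaching level `a d` crosses
the strip. -/
theorem exists_strip_rhombus (hK : IsTiling a θ K) (hp : Positive θ)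
    (ha : ∃ i j, i ≠ j ∧ 0 < a i ∧ 0 < a j) {d : Fin n} (hd : ∀ m, d < m → a m = 0)
    (hpush : Pushed a d K) {F : Face n} (hF : F ∈ K) (hFd : F.top d = a d) :
    ∃ J i, i < d ∧ J d + 1 = a d ∧ IsTopEdge a (J + Pi.single d 1) i ∧
      (⟨J, {i, d}⟩ : Face n) ∈ K ∧ F.IsFaceOf ⟨J, {i, d}⟩ := by
  obtain ⟨G, hG, hFG, J, i, k, hik, rfl⟩ := hK.exists_rhombus hp ha hF
  have htop : a d ≤ (⟨J, {i, k}⟩ : Face n).top d := hFd ▸ hFG.2 d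
  have hJd : J d ≠ a d := by
    intro he
    have h1 := (hpush J i he (hK.closed_under_faces _ hG _ (isFaceOf_of_subset (by simp)))).1 k hik
    exact (hK.base_lt_of_mem_dirs hG (m := k) (by simp)).ne h1
  have hle : (⟨J, {i, k}⟩ : Face n).top d ≤ a d := hK.inC _ hG d
  have hmem : d ∈ (⟨J, {i, k}⟩ : Face n).dirs := by
    by_contra hcon
    rw [Face.top_of_notMem hcon] at htop hle
    exact hJd (le_antisymm hle htop)
  have hkd := hK.le_of_mem_dirs hd hG (m := k) (by simp)
  have hdk : d = k := by
    rcases Finset.mem_insert.1 hmem with rfl | h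
    · exact absurd hik (not_lt.2 hkd)
    · exact Finset.mem_singleton.1 h
  subst hdk
  rw [Face.top_of_mem hmem] at htop hle
  have hJ1 : J d + 1 = a d := le_antisymm hle htop
  refine ⟨J, i, hik, hJ1, hpush _ _ (by simpa using hJ1) ?_, hG, hFG⟩
  exact hK.closed_under_faces _ hG _
    (isFaceOf_of_subset_add (by simp) (by simp) (by simpa using hik.ne'))

/-- Boundary edges belong to every tiling. In a pushed tiling, the rhombus just below such an edge
at level `a d` must go down in direction `d`, which determines it. -/
theorem mem_of_pushed {K' : Set (Face n)} (hK : IsTiling a θ K) (hK' : IsTiling a θ K')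
    (hp : Positive θ) (ha : ∃ i j, i ≠ j ∧ 0 < a i ∧ 0 < a j) {d : Fin n}
    (hd : ∀ m, d < m → a m = 0) (hpush : Pushed a d K) (hpush' : Pushed a d K') {F : Face n}
    (hF : F ∈ K) (hFd : F.top d = a d) : F ∈ K' := by
  obtain ⟨J, i, hid, hJd, htop, hG, hFG⟩ := hK.exists_strip_rhombus hp ha hd hpush hF hFd
  refine hK'.closed_under_faces _ ?_ F hFG
  have hEK : (⟨J + Pi.single d 1, {i}⟩ : Face n) ∈ K :=
    hK.closed_under_faces _ hG _
      (isFaceOf_of_subset_add (by simp) (by simp) (by simpa using hid.ne'))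
  have hE := hK'.mem_of_isTopEdge hp (hK.inC _ hEK) htop
  have hJa : ∀ m, (J + Pi.single d 1 : Fin n → ℕ) m ≤ a m := fun m =>
    (Face.base_le_top _ m).trans (hK.inC _ hEK m)
  have hJ1 : (J + Pi.single d 1 : Fin n → ℕ) d = a d := by simpa using hJd
  rcases hK'.exists_rhombus_below hp hE (Or.inl ⟨d, hid, by rw [hJ1]; omega⟩) with
    ⟨k, hk, hH⟩ | ⟨k, hk, J', hJ', hH⟩
  · exfalso
    have h1 := (hpush' _ k hJ1 (hK'.closed_under_faces _ hH _
      (isFaceOf_of_subset (by simp)))).1 i hk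
    exact (hK'.base_lt_of_mem_dirs hH (m := i) (by simp)).ne h1
  · by_cases hkd : k = d
    · subst hkd
      rwa [add_right_cancel hJ']
    · exfalso
      have hJd' : J' d = a d := by
        have := congrFun hJ' d
        rw [hJ1] at this
        simpa [Ne.symm hkd] using this.symm
      have h1 := (hpush' _ i hJd' (hK'.closed_under_faces _ hH _
        (isFaceOf_of_subset (by simp)))).1 k hk
      exact (hK'.base_lt_of_mem_dirs hH (m := k) (by simp)).ne h1

/-- Only surjectivity needs work. If `x` in the smaller box lifts to `y` in a strip rhombus, the
inner edge of that rhombus is a top edge of the smaller box, so `det (v_i, ·)` separates the strip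
from the box. Equality of the projections then places `y` on that inner edge, which survives. -/
theorem shrink_of_pushed (hK : IsTiling a θ K) (hp : Positive θ)
    (ha : ∃ i j, i ≠ j ∧ 0 < a i ∧ 0 < a j) {d : Fin n} (hd : ∀ m, d < m → a m = 0)
    (hpush : Pushed a d K) : IsTiling (shrink a d) θ (K ∩ {F | InC (shrink a d) F}) where
  inC F hF := hF.2
  closed_under_faces G hG F hFG := ⟨hK.closed_under_faces G hG.1 F hFG, hFG.2.trans hG.2⟩
  dim_le_two F hF := hK.dim_le_two F hF.1
  injOn := hK.injOn.mono fun x hx => by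
    obtain ⟨F, hF, hxF⟩ := mem_space.1 hx
    exact mem_space.2 ⟨F, hF.1, hxF⟩
  surj x hx := by
    have hxa : x ∈ boxC a := by
      rw [mem_boxC] at hx ⊢
      intro m
      have : (shrink a d m : ℝ) ≤ a m := by exact_mod_cast shrink_le a d m
      exact ⟨(hx m).1, (hx m).2.trans this⟩
    obtain ⟨y, hy, hxy⟩ := hK.surj x hxa
    refine ⟨y, ?_, hxy⟩
    obtain ⟨F, hF, hyF⟩ := mem_space.1 hy
    by_cases hC : InC (shrink a d) F
    · exact mem_space.2 ⟨F, ⟨hF, hC⟩, hyF⟩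
    obtain ⟨J, i, hid, hJd, htop, hG, hFG⟩ :=
      hK.exists_strip_rhombus hp ha hd hpush hF (top_eq_of_not_inC (hK.inC F hF) hC)
    have hyG := Face.mem_toSet.1 (hFG.toSet_subset hyF)
    have htop' : IsTopEdge (shrink a d) J i := by
      refine ⟨fun m hm => ?_, fun m hm => ?_⟩
      · by_cases hmd : m = d
        · subst hmd; rw [shrink_self]; omega
        · rw [shrink_of_ne a hmd]
          have := htop.1 m hm
          simpa [hmd] using this
      · have := htop.2 m hm
        simpa [(hm.trans hid).ne] using this
    have hyoff : ∀ m, m ≠ i → m ≠ d → y m = J m := by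
      intro m hmi hmd
      have h1 := hyG m
      rw [Face.top_of_notMem (by simp [hmi, hmd])] at h1
      exact le_antisymm h1.2 h1.1
    have hterm : ∀ m ∈ Finset.univ, 0 ≤ (y m - x m) * cr θ i m := by
      intro m _
      have h1 := htop'.term_nonpos hp hx m
      have h2 : 0 ≤ (y m - J m) * cr θ i m := by
        by_cases hmi : m = i
        · rw [hmi, cr_self, mul_zero]
        · by_cases hmd : m = d
          · subst hmd
            exact mul_nonneg (by have := (hyG m).1; linarith) (hp _ _ hid).le
          · rw [hyoff m hmi hmd, sub_self, zero_mul]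
      linarith [sub_mul (y m) (x m) (cr θ i m), sub_mul (y m) (J m : ℝ) (cr θ i m),
        sub_mul (x m) (J m : ℝ) (cr θ i m)]
    have hzero := (Finset.sum_eq_zero_iff_of_nonneg hterm).1 (sum_sub_cr_eq_zero hxy i) d
      (Finset.mem_univ d)
    have hyd : y d = J d := by
      have h1 : y d = x d := by
        rcases mul_eq_zero.1 hzero with h | h
        · linarith
        · exact absurd h (hp.ne_zero hid.ne)
      have h2 := (mem_boxC.1 hx d).2
      have h3 : shrink a d d = J d := by rw [shrink_self]; omega
      rw [h3] at h2
      have h4 := (hyG d).1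
      refine le_antisymm (by rw [h1]; exact h2) h4
    have hEG : (⟨J, {i}⟩ : Face n).IsFaceOf ⟨J, {i, d}⟩ := isFaceOf_of_subset (by simp)
    have hE := hK.closed_under_faces _ hG _ hEG
    refine mem_space.2 ⟨⟨J, {i}⟩, ⟨hE, ?_⟩, ?_⟩
    · refine le_shrink_of_le (hK.inC _ hE) ?_
      rw [Face.top_of_notMem (by simpa using hid.ne')]
      show J d < a d
      omega
    · rw [Face.mem_toSet]
      intro m
      by_cases hmi : m = i
      · subst hmi
        rw [Face.top_of_mem (by simp)]
        have h1 := hyG m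
        rwa [Face.top_of_mem (by simp)] at h1
      · rw [Face.top_of_notMem (by simpa using hmi)]
        have : y m = J m := by
          by_cases hmd : m = d
          · rw [hmd, hyd]
          · exact hyoff m hmi hmd
        rw [this]; exact ⟨le_rfl, le_rfl⟩

end IsTiling

/-- Cubes of the smaller box have no faces outside it, so the cells of `S` are untouched by its
flips. -/
theorem Step.union {a' I₀ : Fin n → ℕ} (ha : a' ≤ a) {X Y S : Set (Face n)}
    (hS : ∀ F ∈ S, ¬ InC a' F) (h : Step a' I₀ X Y) : Step a I₀ (X ∪ S) (Y ∪ S) := by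
  obtain ⟨I, j, k, l, hjk, hkl, hC, h⟩ := h
  have hdis : ∀ w, S \ star (cube I j k l) w = S := by
    intro w
    refine sdiff_eq_left.2 (Set.disjoint_left.2 fun F hF hFs => hS F hF ?_)
    exact hFs.1.2.trans hC
  refine ⟨I, j, k, l, hjk, hkl, hC.trans ha, ?_⟩
  rcases h with ⟨hs, rfl, hI⟩ | ⟨hs, rfl, hI⟩
  · refine Or.inl ⟨hs.trans Set.subset_union_left, ?_, hI⟩
    rw [Set.union_sdiff_distrib, hdis, Set.union_right_comm]
  · refine Or.inr ⟨hs.trans Set.subset_union_left, ?_, hI⟩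
    rw [Set.union_sdiff_distrib, hdis, Set.union_right_comm]

/-! ### The central symmetry of `C`. -/

section Reflection

open Classical in
/-- The central symmetry of `C`, acting on cells. -/
def reflectFace (a : Fin n → ℕ) (F : Face n) : Face n :=
  if InC a F then ⟨a - F.top, F.dirs⟩ else F

theorem reflectFace_base {F : Face n} (h : InC a F) : (reflectFace a F).base = a - F.top := by
  simp [reflectFace, h]

theorem reflectFace_dirs (F : Face n) : (reflectFace a F).dirs = F.dirs := by
  unfold reflectFace; split_ifs <;> rfl

theorem reflectFace_top {F : Face n} (h : InC a F) : (reflectFace a F).top = a - F.base := by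
  funext m
  have h1 : F.top m ≤ a m := h m
  have h2 := congrFun (reflectFace_base h) m
  rw [Pi.sub_apply] at h2 ⊢
  by_cases hm : m ∈ F.dirs
  · rw [Face.top_of_mem (by rwa [reflectFace_dirs]), h2]
    rw [Face.top_of_mem hm] at h1 ⊢
    omega
  · rw [Face.top_of_notMem (by rwa [reflectFace_dirs]), h2, Face.top_of_notMem hm]

theorem inC_reflectFace {F : Face n} : InC a (reflectFace a F) ↔ InC a F := by
  by_cases h : InC a F
  · refine ⟨fun _ => h, fun _ => ?_⟩
    rw [InC, reflectFace_top h]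
    exact tsub_le_self
  · simp [reflectFace, h]

theorem reflectFace_reflectFace (F : Face n) : reflectFace a (reflectFace a F) = F := by
  by_cases h : InC a F
  · have h' := inC_reflectFace.2 h
    refine Face.ext ?_ (by rw [reflectFace_dirs, reflectFace_dirs])
    rw [reflectFace_base h', reflectFace_top h, tsub_tsub_cancel_of_le]
    exact F.base_le_top.trans h
  · simp [reflectFace, h]

theorem _root_.CubeRecurrence.Face.IsFaceOf.reflectFace {F G : Face n} (h : F.IsFaceOf G)
    (hG : InC a G) : (reflectFace a F).IsFaceOf (reflectFace a G) := by
  have hF : InC a F := h.2.trans hG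
  refine ⟨?_, ?_⟩
  · rw [reflectFace_base hF, reflectFace_base hG]; exact tsub_le_tsub_left h.2 a
  · rw [reflectFace_top hF, reflectFace_top hG]; exact tsub_le_tsub_left h.1 a

/-- The central symmetry of `C`, acting on collections of cells. -/
def reflect (a : Fin n → ℕ) (K : Set (Face n)) : Set (Face n) := {F | reflectFace a F ∈ K}

theorem reflect_reflect (K : Set (Face n)) : reflect a (reflect a K) = K := by
  ext F
  simp only [reflect, Set.mem_ofPred_eq, reflectFace_reflectFace]

theorem reflectFace_mem_star {Q F : Face n} {w : Fin n → ℕ} (hQ : InC a Q) (hF : F ∈ star Q w) :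
    reflectFace a F ∈ star (reflectFace a Q) (a - w) := by
  obtain ⟨hFQ, hdim, hw⟩ := hF
  have hFC : InC a F := hFQ.2.trans hQ
  rw [Face.vertex_isFaceOf] at hw
  refine ⟨hFQ.reflectFace hQ, ?_, Face.vertex_isFaceOf.2 ⟨?_, ?_⟩⟩
  · rwa [Face.dim, reflectFace_dirs]
  · rw [reflectFace_base hFC]; exact tsub_le_tsub_left hw.2 a
  · rw [reflectFace_top hFC]; exact tsub_le_tsub_left hw.1 a

theorem reflect_star {Q : Face n} {w : Fin n → ℕ} (hQ : InC a Q) (hw : w ≤ a) :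
    reflect a (star Q w) = star (reflectFace a Q) (a - w) := by
  ext F
  constructor
  · intro hF
    have := reflectFace_mem_star hQ hF
    rwa [reflectFace_reflectFace] at this
  · intro hF
    have := reflectFace_mem_star (inC_reflectFace.2 hQ) hF
    rwa [reflectFace_reflectFace, tsub_tsub_cancel_of_le hw] at this

theorem mem_toSet_reflectFace {F : Face n} (h : InC a F) {x : Fin n → ℝ} (hx : x ∈ F.toSet) :
    (fun m => (a m : ℝ)) - x ∈ (reflectFace a F).toSet := by
  rw [Face.mem_toSet] at hx ⊢
  intro m
  have h1 : F.top m ≤ a m := h m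
  have h2 : F.base m ≤ a m := (F.base_le_top m).trans h1
  rw [reflectFace_base h, reflectFace_top h, Pi.sub_apply, Pi.sub_apply, Pi.sub_apply,
    Nat.cast_sub h1, Nat.cast_sub h2]
  constructor <;> linarith [(hx m).1, (hx m).2]

theorem IsTiling.mem_space_reflect (hK : IsTiling a θ K) {x : Fin n → ℝ} :
    x ∈ space (reflect a K) ↔ (fun m => (a m : ℝ)) - x ∈ space K := by
  simp only [mem_space]
  constructor
  · rintro ⟨F, hF, hx⟩
    exact ⟨_, hF, mem_toSet_reflectFace (inC_reflectFace.1 (hK.inC _ hF)) hx⟩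
  · rintro ⟨F, hF, hx⟩
    refine ⟨reflectFace a F, ?_, ?_⟩
    · rw [reflect, Set.mem_ofPred_eq, reflectFace_reflectFace]; exact hF
    · have := mem_toSet_reflectFace (hK.inC F hF) hx
      rwa [sub_sub_cancel] at this

theorem IsTiling.reflect (hK : IsTiling a θ K) : IsTiling a θ (reflect a K) where
  inC F hF := inC_reflectFace.1 (hK.inC _ hF)
  closed_under_faces G hG F hFG :=
    hK.closed_under_faces _ hG _ (hFG.reflectFace (inC_reflectFace.1 (hK.inC _ hG)))
  dim_le_two F hF := by
    have := hK.dim_le_two _ hF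
    rwa [Face.dim, reflectFace_dirs] at this
  injOn x hx y hy hxy := by
    have := hK.injOn (hK.mem_space_reflect.1 hx) (hK.mem_space_reflect.1 hy)
      (by rw [proj_sub, proj_sub, hxy])
    exact sub_right_injective this
  surj x hx := by
    have hx' : (fun m => (a m : ℝ)) - x ∈ boxC a := by
      rw [mem_boxC] at hx ⊢
      intro m
      rw [Pi.sub_apply]
      constructor <;> linarith [(hx m).1, (hx m).2]
    obtain ⟨y, hy, hxy⟩ := hK.surj _ hx'
    refine ⟨(fun m => (a m : ℝ)) - y, hK.mem_space_reflect.2 (by rwa [sub_sub_cancel]), ?_⟩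
    rw [proj_sub, hxy, proj_sub, sub_sub_cancel]

theorem reflectFace_cube {I : Fin n → ℕ} {j k l : Fin n} (hC : InC a (cube I j k l)) :
    reflectFace a (cube I j k l) = cube (a - (cube I j k l).top) j k l :=
  Face.ext (reflectFace_base hC) (reflectFace_dirs _)

theorem sub_topVertex {I : Fin n → ℕ} {j k l : Fin n} (hjk : j < k) (hkl : k < l)
    (hC : InC a (cube I j k l)) :
    a - topVertex I j l = botVertex (a - (cube I j k l).top) k := by
  have hjl := hjk.trans hkl
  funext m
  have h1 : (cube I j k l).top m ≤ a m := hC m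
  simp only [botVertex, topVertex, cube, Face.top, Pi.add_apply, Pi.sub_apply, Pi.single_apply,
      Finset.mem_insert, Finset.mem_singleton] at h1 ⊢
  by_cases h2 : m = j
  · subst h2; simp [hjk.ne, hjl.ne]
  · by_cases h3 : m = k
    · subst h3
      simp [hkl.ne, h2] at h1 ⊢
      omega
    · simp [h2, h3] at h1 ⊢

theorem sub_botVertex {I : Fin n → ℕ} {j k l : Fin n} (hjk : j < k) (hkl : k < l)
    (hC : InC a (cube I j k l)) :
    a - botVertex I k = topVertex (a - (cube I j k l).top) j l := by
  have hjl := hjk.trans hkl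
  funext m
  have h1 : (cube I j k l).top m ≤ a m := hC m
  simp only [botVertex, topVertex, cube, Face.top, Pi.add_apply, Pi.sub_apply, Pi.single_apply,
      Finset.mem_insert, Finset.mem_singleton] at h1 ⊢
  by_cases h2 : m = j
  · subst h2
    simp [hjk.ne, hjl.ne] at h1 ⊢
    omega
  · by_cases h3 : m = k
    · subst h3
      simp [hkl.ne, h2]
    · by_cases h4 : m = l
      · subst h4
        simp [h2, h3] at h1 ⊢
        omega
      · simp [h2, h3, h4]

theorem topVertex_le {I : Fin n → ℕ} {j k l : Fin n} (hjk : j < k) (hkl : k < l)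
    (hC : InC a (cube I j k l)) : topVertex I j l ≤ a := by
  refine le_trans (fun m => ?_) hC
  have hjl := hjk.trans hkl
  simp only [topVertex, cube, Face.top, Pi.add_apply, Pi.single_apply,
      Finset.mem_insert, Finset.mem_singleton]
  by_cases h2 : m = j
  · subst h2; simp [hjl.ne]
  · by_cases h4 : m = l
    · subst h4; simp [h2]
    · simp [h2, h4]

theorem botVertex_le {I : Fin n → ℕ} {j k l : Fin n}
    (hC : InC a (cube I j k l)) : botVertex I k ≤ a := by
  refine le_trans (fun m => ?_) hC
  simp only [botVertex, cube, Face.top, Pi.add_apply, Pi.single_apply,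
      Finset.mem_insert, Finset.mem_singleton]
  by_cases h2 : m = k <;> simp [h2]

/-- The symmetry exchanges the top vertex and the bottom vertex of a cube, so the two kinds of flip
change places. -/
theorem Step.reflect {I₀ : Fin n → ℕ} (hI₀ : I₀ ≤ a) {K K' : Set (Face n)}
    (h : Step a I₀ K K') : Step a (a - I₀) (reflect a K) (reflect a K') := by
  obtain ⟨I, j, k, l, hjk, hkl, hC, h⟩ := h
  have htop := topVertex_le hjk hkl hC
  have hbot := botVertex_le hC
  have hst := reflect_star hC htop
  have hsb := reflect_star hC hbot
  rw [reflectFace_cube hC, sub_topVertex hjk hkl hC] at hst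
  rw [reflectFace_cube hC, sub_botVertex hjk hkl hC] at hsb
  have hC' : InC a (cube (a - (cube I j k l).top) j k l) := by
    rw [← reflectFace_cube hC]; exact inC_reflectFace.2 hC
  have hinj : ∀ w, w ≤ a → I₀ ≠ w → a - I₀ ≠ a - w := by
    intro w hw hne he
    apply hne
    rw [← tsub_tsub_cancel_of_le hI₀, he, tsub_tsub_cancel_of_le hw]
  refine ⟨_, j, k, l, hjk, hkl, hC', ?_⟩
  rcases h with ⟨hs, rfl, hI⟩ | ⟨hs, rfl, hI⟩
  · right
    rw [← hst, ← hsb, ← sub_topVertex hjk hkl hC]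
    exact ⟨fun F hF => hs hF, rfl, hinj _ htop hI⟩
  · left
    rw [← hst, ← hsb, ← sub_botVertex hjk hkl hC]
    exact ⟨fun F hF => hs hF, rfl, hinj _ hbot hI⟩

end Reflection

/-! ### Normal forms by induction on the size of the box. -/

/-- All tilings can be flipped to the same collection of cells without removing `I₀`. -/
def HasNormalForm (a : Fin n → ℕ) (θ : Fin n → ℝ) (I₀ : Fin n → ℕ) : Prop :=
  ∃ N : Set (Face n), ∀ K, IsTiling a θ K → Relation.ReflTransGen (Step a I₀) K N

theorem HasNormalForm.of_reflect {I₀ : Fin n → ℕ} (hI₀ : I₀ ≤ a)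
    (h : HasNormalForm a θ (a - I₀)) : HasNormalForm a θ I₀ := by
  obtain ⟨N, hN⟩ := h
  refine ⟨reflect a N, fun K hK => ?_⟩
  have h1 : Relation.ReflTransGen (Step a (a - (a - I₀))) (reflect a (reflect a K))
      (reflect a N) :=
    (hN _ hK.reflect).lift (reflect a) fun X Y hXY => hXY.reflect tsub_le_self
  rwa [reflect_reflect, tsub_tsub_cancel_of_le hI₀] at h1

/-- All pushed tilings share the same outer layer, so the normal form of the smaller box together
with that layer serves for `a`. -/
theorem HasNormalForm.of_shrink (hp : Positive θ) (ha : ∃ i j, i ≠ j ∧ 0 < a i ∧ 0 < a j)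
    {d : Fin n} (hd : ∀ m, d < m → a m = 0) (had : 0 < a d) {I₀ : Fin n → ℕ} (hI₀ : I₀ d < a d)
    (h : HasNormalForm (shrink a d) θ I₀) : HasNormalForm a θ I₀ := by
  obtain ⟨N, hN⟩ := h
  by_cases hex : ∃ K₀, IsTiling a θ K₀ ∧ Pushed a d K₀
  · obtain ⟨K₀, hK₀, hpush₀⟩ := hex
    refine ⟨N ∪ (K₀ \ {F | InC (shrink a d) F}), fun K hK => ?_⟩
    obtain ⟨K₁, h1, hK₁, hpush₁⟩ := IsTiling.exists_pushed hp hd had hI₀ _ K hK le_rfl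
    refine h1.trans ?_
    have heq : K₁ \ {F | InC (shrink a d) F} = K₀ \ {F | InC (shrink a d) F} := by
      ext F
      constructor
      · rintro ⟨hF, hC⟩
        exact ⟨hK₁.mem_of_pushed hK₀ hp ha hd hpush₁ hpush₀ hF
          (top_eq_of_not_inC (hK₁.inC F hF) hC), hC⟩
      · rintro ⟨hF, hC⟩
        exact ⟨hK₀.mem_of_pushed hK₁ hp ha hd hpush₀ hpush₁ hF
          (top_eq_of_not_inC (hK₀.inC F hF) hC), hC⟩
    have h3 : K₁ ∩ {F | InC (shrink a d) F} ∪ (K₀ \ {F | InC (shrink a d) F}) = K₁ := by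
      rw [← heq, Set.inter_union_sdiff]
    have h2 : Relation.ReflTransGen (Step a I₀)
        (K₁ ∩ {F | InC (shrink a d) F} ∪ (K₀ \ {F | InC (shrink a d) F}))
        (N ∪ (K₀ \ {F | InC (shrink a d) F})) := (hN _ (hK₁.shrink_of_pushed hp ha hd hpush₁)).lift
      (fun X => X ∪ (K₀ \ {F | InC (shrink a d) F}))
      fun X Y hXY => hXY.union (shrink_le a d) fun F hF => hF.2
    rwa [h3] at h2
  -- Every tiling can be pushed, so without a pushed tiling there is no tiling and any choice works.
  · refine ⟨∅, fun K hK => ?_⟩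
    obtain ⟨K₁, -, hK₁, hpush₁⟩ := IsTiling.exists_pushed hp hd had hI₀ _ K hK le_rfl
    exact absurd ⟨K₁, hK₁, hpush₁⟩ hex

theorem hasNormalForm (hp : Positive θ) (s : ℕ) : ∀ (a I₀ : Fin n → ℕ), ∑ m, a m ≤ s → I₀ ≤ a →
    HasNormalForm a θ I₀ := by
  induction s with
  | zero =>
    intro a I₀ hs _
    refine ⟨{F | InC a F}, fun K hK => ?_⟩
    rw [hK.eq_setOf_inC]
    rintro ⟨i, -, -, hi, -⟩
    have := Finset.single_le_sum (fun m _ => Nat.zero_le (a m)) (Finset.mem_univ i)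
    omega
  | succ s ih =>
    intro a I₀ hs hI₀
    by_cases ha : ∃ i j, i ≠ j ∧ 0 < a i ∧ 0 < a j
    · obtain ⟨d, had, hd⟩ : ∃ d, 0 < a d ∧ ∀ m, d < m → a m = 0 := by
        obtain ⟨i, -, -, hi, -⟩ := ha
        obtain ⟨d, hd, hmax⟩ := Finset.exists_max_image (Finset.univ.filter fun m => 0 < a m) id
          ⟨i, by simpa using hi⟩
        refine ⟨d, by simpa using hd, fun m hm => ?_⟩
        by_contra hne
        exact absurd (hmax m (by simpa using Nat.pos_of_ne_zero hne)) (not_le.2 hm)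
      have key : ∀ J₀ : Fin n → ℕ, J₀ ≤ a → J₀ d < a d → HasNormalForm a θ J₀ := by
        intro J₀ hJ₀ hlt
        refine HasNormalForm.of_shrink hp ha hd had hlt (ih _ _ ?_ (le_shrink_of_le hJ₀ hlt))
        have : ∑ m, shrink a d m < ∑ m, a m :=
          Finset.sum_lt_sum (fun m _ => shrink_le a d m)
            ⟨d, Finset.mem_univ d, by rw [shrink_self]; omega⟩
        omega
      rcases (hI₀ d).lt_or_eq with hlt | heq
      · exact key I₀ hI₀ hlt
      -- Reflection sends level `a d` to level `0`, below `a d`, where pushing the last strip is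
      -- harmless.
      · refine HasNormalForm.of_reflect hI₀ (key _ tsub_le_self ?_)
        rw [Pi.sub_apply, heq, Nat.sub_self]
        exact had
    · refine ⟨{F | InC a F}, fun K hK => ?_⟩
      rw [hK.eq_setOf_inC ha]

/-! ### Back to tilings and sequences of flips. -/

theorem Tiling.isTiling (T : Tiling a θ) : IsTiling a θ T.faces where
  inC := T.inC
  closed_under_faces := T.closed_under_faces
  dim_le_two := T.dim_le_two
  injOn x hx y hy hxy := by
    obtain ⟨h, hh⟩ := T.homeo
    have : h ⟨x, hx⟩ = h ⟨y, hy⟩ := Subtype.ext (by rw [hh, hh]; exact hxy)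
    exact congrArg Subtype.val (h.injective this)
  surj x hx := by
    obtain ⟨h, hh⟩ := T.homeo
    refine ⟨h.symm ⟨proj θ x, x, hx, rfl⟩, (h.symm _).2, ?_⟩
    rw [← hh, h.apply_symm_apply]

theorem IsTiling.exists_homeo (hK : IsTiling a θ K) :
    ∃ h : space K ≃ₜ zonogon a θ, ∀ x, (h x : ℝ × ℝ) = proj θ x := by
  have hbij : Function.Bijective fun x : space K =>
      (⟨proj θ x, x, hK.space_subset x.2, rfl⟩ : zonogon a θ) := by
    constructor
    · intro x y hxy
      exact Subtype.ext (hK.injOn x.2 y.2 (congrArg Subtype.val hxy))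
    · rintro ⟨_, x, hx, rfl⟩
      obtain ⟨y, hy, hxy⟩ := hK.surj x hx
      exact ⟨⟨y, hy⟩, Subtype.ext hxy⟩
  have : CompactSpace (space K) := isCompact_iff_compactSpace.1 hK.isCompact_space
  have hcont : Continuous (Equiv.ofBijective _ hbij) :=
    ((continuous_proj θ).comp continuous_subtype_val).subtype_mk _
  exact ⟨hcont.homeoOfEquivCompactToT2, fun x => rfl⟩

/-- The tiling with the given cells. -/
def IsTiling.toTiling (hK : IsTiling a θ K) : Tiling a θ where
  faces := K
  inC := hK.inC
  closed_under_faces := hK.closed_under_faces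
  dim_le_two := hK.dim_le_two
  homeo := hK.exists_homeo

theorem vertex_mem_star {Q : Face n} {v w : Fin n → ℕ} (h : Face.vertex v ∈ star Q w) : v = w := by
  have := Face.vertex_isFaceOf.1 h.2.2
  rw [Face.vertex_base, Face.vertex_top] at this
  exact le_antisymm this.1 this.2

theorem Step.vertex_mem {I₀ : Fin n → ℕ} {K K' : Set (Face n)} (h : Step a I₀ K K')
    (hI : Face.vertex I₀ ∈ K) : Face.vertex I₀ ∈ K' := by
  obtain ⟨I, j, k, l, -, -, -, ⟨-, rfl, hne⟩ | ⟨-, rfl, hne⟩⟩ := h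
  · exact Or.inl ⟨hI, fun h => hne (vertex_mem_star h)⟩
  · exact Or.inl ⟨hI, fun h => hne (vertex_mem_star h)⟩

theorem rhombi_star {S X Y : Set (Face n)} :
    {F ∈ S \ X ∪ Y | F.dim = 2} = ({F ∈ S | F.dim = 2} \ {F ∈ X | F.dim = 2}) ∪
      {F ∈ Y | F.dim = 2} := by
  ext F
  simp only [Set.mem_union, Set.mem_sdiff, Set.mem_ofPred_eq]
  tauto

theorem topFaces_eq (I : Fin n → ℕ) (j k l : Fin n) :
    topFaces I j k l = {F ∈ star (cube I j k l) (topVertex I j l) | F.dim = 2} := by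
  ext F
  simp only [topFaces, star, topVertex, Set.mem_ofPred_eq]
  constructor
  · rintro ⟨h1, h2, h3⟩; exact ⟨⟨h1, h2.le, h3⟩, h2⟩
  · rintro ⟨⟨h1, -, h3⟩, h2⟩; exact ⟨h1, h2, h3⟩

theorem bottomFaces_eq (I : Fin n → ℕ) (j k l : Fin n) :
    bottomFaces I j k l = {F ∈ star (cube I j k l) (botVertex I k) | F.dim = 2} := by
  ext F
  simp only [bottomFaces, star, botVertex, Set.mem_ofPred_eq]
  constructor
  · rintro ⟨h1, h2, h3⟩; exact ⟨⟨h1, h2.le, h3⟩, h2⟩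
  · rintro ⟨⟨h1, -, h3⟩, h2⟩; exact ⟨h1, h2, h3⟩

theorem Step.flip {I₀ : Fin n → ℕ} {T T' : Tiling a θ} (h : Step a I₀ T.faces T'.faces) :
    Flip T T' := by
  obtain ⟨I, j, k, l, hjk, hkl, hC, h⟩ := h
  refine ⟨I, j, k, l, hjk, hkl, hC, ?_⟩
  rw [topFaces_eq, bottomFaces_eq]
  simp only [Tiling.rhombi]
  rcases h with ⟨hs, he, -⟩ | ⟨hs, he, -⟩
  · left
    rw [he]
    exact ⟨fun F hF => ⟨hs hF.1, hF.2⟩, rhombi_star⟩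
  · right
    rw [he]
    exact ⟨fun F hF => ⟨hs hF.1, hF.2⟩, rhombi_star⟩

/-- A flip can be undone. -/
theorem Step.symm {I₀ : Fin n → ℕ} {K K' : Set (Face n)} (hp : Positive θ) (hK : IsTiling a θ K)
    (hI : Face.vertex I₀ ∈ K) (h : Step a I₀ K K') : Step a I₀ K' K := by
  obtain ⟨I, j, k, l, hjk, hkl, hC, h⟩ := h
  obtain ⟨u, hu⟩ := flipData_cube hp I hjk hkl
  have hback : ∀ {A B : Set (Face n)}, A ⊆ K → Disjoint K B → K = (K \ A ∪ B) \ B ∪ A := by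
    intro A B hA hB
    rw [Set.union_sdiff_right, sdiff_eq_left.2 (hB.mono_left Set.sdiff_subset),
      Set.sdiff_union_of_subset hA]
  -- The reverse flip removes `w`, which is new, whereas `I₀` was already in `K`.
  have hne : ∀ {Q : Face n} {w w' : Fin n → ℕ} {u : Fin n → ℝ}, FlipData θ Q w w' u →
      star Q w' ⊆ K → I₀ ≠ w := by
    rintro Q w w' u hu hs rfl
    refine Set.disjoint_left.1 (hu.disjoint hK hs) hI ⟨?_, ?_, Face.IsFaceOf.refl _⟩
    · exact Face.vertex_isFaceOf.2 ⟨fun m => (hu.vertex_mem m).1, fun m => (hu.vertex_mem m).2⟩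
    · simp [Face.dim, Face.vertex]
  refine ⟨I, j, k, l, hjk, hkl, hC, ?_⟩
  rcases h with ⟨hs, rfl, -⟩ | ⟨hs, rfl, -⟩
  · exact Or.inr ⟨Set.subset_union_right, hback hs (hu.disjoint hK hs), hne hu hs⟩
  · exact Or.inl ⟨Set.subset_union_right, hback hs (hu.symm.disjoint hK hs), hne hu.symm hs⟩

/-- The tilings are related by a flip keeping the vertex `I₀`, which belongs to both of them. -/
def FlipKeeping (I₀ : Fin n → ℕ) (T T' : Tiling a θ) : Prop :=
  Step a I₀ T.faces T'.faces ∧ I₀ ∈ T.vert ∧ I₀ ∈ T'.vert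

theorem FlipKeeping.symm {I₀ : Fin n → ℕ} (hp : Positive θ) {T T' : Tiling a θ}
    (h : FlipKeeping I₀ T T') : FlipKeeping I₀ T' T :=
  ⟨h.1.symm hp T.isTiling h.2.1, h.2.2, h.2.1⟩

theorem exists_reflTransGen_flipKeeping {I₀ : Fin n → ℕ} (hp : Positive θ) {N : Set (Face n)}
    (h : Relation.ReflTransGen (Step a I₀) K N) :
    ∀ T : Tiling a θ, T.faces = K → I₀ ∈ T.vert →
      ∃ T' : Tiling a θ, T'.faces = N ∧ Relation.ReflTransGen (FlipKeeping I₀) T T' := by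
  induction h using Relation.ReflTransGen.head_induction_on with
  | refl => exact fun T hT _ => ⟨T, hT, Relation.ReflTransGen.refl⟩
  | head hstep _ ih =>
    rintro T rfl hI
    have hT' := T.isTiling.step hp hstep
    have hI' : I₀ ∈ hT'.toTiling.vert := hstep.vertex_mem hI
    obtain ⟨T', h1, h2⟩ := ih hT'.toTiling rfl hI'
    exact ⟨T', h1, h2.head ⟨hstep, hI, hI'⟩⟩

theorem exists_flip_sequence {I₀ : Fin n → ℕ} {T T' : Tiling a θ} (hI : I₀ ∈ T'.vert)
    (h : Relation.ReflTransGen (FlipKeeping I₀) T T') :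
    ∃ (m : ℕ) (S : ℕ → Tiling a θ), S 0 = T ∧ S m = T' ∧
      (∀ i < m, Flip (S i) (S (i + 1))) ∧ ∀ i ≤ m, I₀ ∈ (S i).vert := by
  induction h using Relation.ReflTransGen.head_induction_on with
  | refl => exact ⟨0, fun _ => T', rfl, rfl, fun i hi => absurd hi (Nat.not_lt_zero i), fun _ _ => hI⟩
  | @head X Y hstep _ ih =>
    obtain ⟨m, S, h0, hm, hflip, hvert⟩ := ih
    refine ⟨m + 1, fun i => Nat.casesOn i X S, rfl, hm, ?_, ?_⟩
    · rintro (_ | i) hi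
      · show Flip X (S 0)
        rw [h0]; exact hstep.1.flip
      · exact hflip i (by omega)
    · rintro (_ | i) hi
      · exact hstep.2.1
      · exact hvert i (by omega)

end CubeRecurrence

end

theorem proposition3p12 (n : ℕ) (hn : 3 ≤ n) (a : Fin n → ℕ) (ha : ∀ i, 0 < a i)
    (θ : Fin n → ℝ) (hθ : StrictMono θ) (hθ0 : ∀ i, 0 < θ i) (hθπ : ∀ i, θ i < Real.pi)
    (T T' : CubeRecurrence.Tiling a θ) (I₀ : Fin n → ℕ) (hT : I₀ ∈ T.vert) (hT' : I₀ ∈ T'.vert) :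
    ∃ (m : ℕ) (S : ℕ → CubeRecurrence.Tiling a θ), S 0 = T ∧ S m = T' ∧
      (∀ i < m, CubeRecurrence.Flip (S i) (S (i + 1))) ∧ ∀ i ≤ m, I₀ ∈ (S i).vert := by
  have hp : CubeRecurrence.Positive θ := fun i j hij =>
    Real.sin_pos_of_pos_of_lt_pi (sub_pos.2 (hθ hij)) (by linarith [hθ0 i, hθπ j])
  have hI₀ : I₀ ≤ a := by
    have := T.inC _ hT
    rwa [CubeRecurrence.InC, CubeRecurrence.Face.vertex_top] at this
  obtain ⟨N, hN⟩ := CubeRecurrence.hasNormalForm hp _ a I₀ le_rfl hI₀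
  obtain ⟨X, hX, hTX⟩ :=
    CubeRecurrence.exists_reflTransGen_flipKeeping hp (hN _ T.isTiling) T rfl hT
  obtain ⟨Y, hY, hTY⟩ :=
    CubeRecurrence.exists_reflTransGen_flipKeeping hp (hN _ T'.isTiling) T' rfl hT'
  obtain rfl : X = Y := CubeRecurrence.Tiling.ext (hX.trans hY.symm)
  have hsymm : Relation.ReflTransGen (CubeRecurrence.FlipKeeping I₀) X T' := by
    have : Std.Symm (CubeRecurrence.FlipKeeping (a := a) (θ := θ) I₀) := ⟨fun _ _ h => h.symm hp⟩
    exact Relation.ReflTransGen.stdSymm.symm _ _ hTY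
  exact CubeRecurrence.exists_flip_sequence hT' (hTX.trans hsymm)
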